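/- Let $\Bbbk$ be a commutative ring and let $\Lambda'=\Bbbk\langle h_1,h_2,\dots\rangle$ be the free associative $\Bbbk$-algebra with $\deg h_n=n$ and $h_0=1$. For a composition $\alpha=(a_1,\dots,a_r)$ put $h_\alpha=h_{a_1}\cdots h_{a_r}$, $|\alpha|=a_1+\dots+a_r$, and let $S_\alpha=S_{a_1}\times\dots\times S_{a_r}\subset S_{|\alpha|}$. For $q\in\Bbbk$ define a symmetric bilinear form on $\Lambda'$ by $$(h_\beta,h_\alpha)=\sum_{c\in S_\beta\backslash S_n/S_\alpha}q^{\ell(c)}\ \text{ if } |\alpha|=|\beta|=n,\qquad (h_\beta,h_\alpha)=0\ \text{ if } |\alpha|\neq|\beta|,$$ where $\ell(c)$ is the minimal Coxeter length of an element of the double coset $c$. Let $\mathcal I^q$ be the radical of this form, $\Lambda^q=\Lambda'/\mathcal I^q$, and let $\Lambda^q_n$ be the image in $\Lambda^q$ of the span of the words $h_\alpha$ with $|\alpha|=n$. Write $\Lambda=\Lambda^{-1}$ (the odd symmetric functions). Define $e_n$ by $e_0=1$ and $\sum_{k=0}^n(-1)^{k(k+1)/2}e_kh_{n-k}=0$ for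 $n\ge1$, and for a partition $\lambda=(\lambda_1\ge\dots\ge\lambda_r)$ let $h_\lambda$ and $e_\lambda$ be the classes in $\Lambda$ of $h_{\lambda_1}\cdots h_{\lambda_r}$ and $e_{\lambda_1}\cdots e_{\lambda_r}$. Then for every $n\ge0$ the $\Bbbk$-module $\Lambda_n$ is free, and each of the families $\{h_\lambda\}_{\lambda\vdash n}$ and $\{e_\lambda\}_{\lambda\vdash n}$ is a basis of it. Hence, if $\Bbbk\neq0$, the rank of $\Lambda_n$ equals the rank of $\Lambda^{1}_n$ (the even case $q=1$), namely the number of partitions of $n$. -/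

import Mathlib

/-- The free associative algebra `Λ'` over `k` on generators `h_1, h_2, …`. -/
abbrev QSymFree (k : Type*) [CommRing k] : Type _ := FreeAlgebra k ℕ+

namespace QSymFree

/-- The element `h_n` of `Λ'`, with the convention `h_0 = 1`. -/
noncomputable def h (k : Type*) [CommRing k] (n : ℕ) : QSymFree k :=
  if hn : 0 < n then FreeAlgebra.ι k (⟨n, hn⟩ : ℕ+) else 1

/-- The degree `a_1 + ⋯ + a_r` of a word `h_{a_1} ⋯ h_{a_r}`. -/
def wordDegree (w : FreeMonoid ℕ+) : ℕ :=
  ((FreeMonoid.toList w).map (fun a : ℕ+ => (a : ℕ))).sum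

/-- The composition `(a_1, …, a_r)` of `n` attached to a word `h_{a_1} ⋯ h_{a_r}` of degree `n`. -/
def wordComposition {n : ℕ} (w : FreeMonoid ℕ+) (hw : wordDegree w = n) : Composition n where
  blocks := (FreeMonoid.toList w).map (fun a : ℕ+ => (a : ℕ))
  blocks_pos := by
    intro i hi
    obtain ⟨a, -, rfl⟩ := List.mem_map.mp hi
    exact a.pos
  blocks_sum := hw

/-- The degree `n` part `Λ'_n`, spanned by the words of degree `n`. -/
noncomputable def degreePart (k : Type*) [CommRing k] (n : ℕ) : Submodule k (QSymFree k) :=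
  Submodule.span k (FreeAlgebra.basisFreeMonoid k ℕ+ '' {w | wordDegree w = n})

/-- The parabolic subgroup `S_α = S_{a_1} × ⋯ × S_{a_r}` of the symmetric group on `n` letters:
the permutations that preserve each of the consecutive blocks of `α`. -/
def parabolic {n : ℕ} (α : Composition n) : Subgroup (Equiv.Perm (Fin n)) where
  carrier := {σ | ∀ i, α.index (σ i) = α.index i}
  mul_mem' := by
    intro σ τ hσ hτ i
    rw [Equiv.Perm.mul_apply, hσ, hτ]
  one_mem' := fun _ => rfl
  inv_mem' := by
    intro σ hσ i
    have := hσ (σ⁻¹ i)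
    rw [show σ (σ⁻¹ i) = i from σ.apply_symm_apply i] at this
    exact this.symm

/-- The Coxeter length of a permutation: the number of pairs `i < j` with `σ i > σ j`. -/
def permLength {n : ℕ} (σ : Equiv.Perm (Fin n)) : ℕ :=
  (Finset.univ.filter (fun p : Fin n × Fin n => p.1 < p.2 ∧ σ p.2 < σ p.1)).card

/-- The set of double cosets `S_β \ S_n / S_α`. -/
abbrev Cosets {n : ℕ} (β α : Composition n) : Type :=
  DoubleCoset.Quotient (parabolic β : Set (Equiv.Perm (Fin n)))
    (parabolic α : Set (Equiv.Perm (Fin n)))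

noncomputable instance {n : ℕ} (β α : Composition n) : Fintype (Cosets β α) :=
  @Fintype.ofFinite _ (Finite.of_surjective
    (DoubleCoset.mk (parabolic β) (parabolic α)) Quotient.mk''_surjective)

/-- The length of a double coset: the minimum of the lengths of its elements. -/
noncomputable def cosetLength {n : ℕ} {β α : Composition n} (c : Cosets β α) : ℕ :=
  sInf (permLength '' {σ | DoubleCoset.mk (parabolic β) (parabolic α) σ = c})

/-- The value `(h_β, h_α)` on two words: the sum of `q ^ ℓ(c)` over the double cosets `c` in
`S_β \ S_n / S_α` if both words have the same degree `n`, and `0` otherwise. -/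
noncomputable def wordForm {k : Type*} [CommRing k] (q : k) (β α : FreeMonoid ℕ+) : k :=
  if hdeg : wordDegree α = wordDegree β then
    ∑ c : Cosets (wordComposition β rfl) (wordComposition α hdeg), q ^ cosetLength c
  else 0

/-- The bilinear form on `Λ'`: the bilinear extension of `wordForm` from the basis of words. -/
noncomputable def form {k : Type*} [CommRing k] (q : k) : LinearMap.BilinForm k (QSymFree k) :=
  (FreeAlgebra.basisFreeMonoid k ℕ+).constr k (fun β =>
    (FreeAlgebra.basisFreeMonoid k ℕ+).constr k (fun α => wordForm q β α))

/-- The radical of the (symmetric) form: all `x` with `(x, y) = 0` for every `y`. -/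
noncomputable def radical {k : Type*} [CommRing k] (q : k) : Submodule k (QSymFree k) :=
  LinearMap.ker (form q)

/-- Representatives in `Λ'` of the odd elementary symmetric functions, given by `e_0 = 1` and
the recursion `∑_{i=0}^n (-1)^{i(i+1)/2} e_i h_{n-i} = 0` for `n ≥ 1`, solved for `e_n`. -/
noncomputable def e (k : Type*) [CommRing k] : ℕ → QSymFree k
  | 0 => 1
  | n + 1 => -((-1 : k) ^ ((n + 1) * (n + 2) / 2)) •
      ∑ i : Fin (n + 1), ((-1 : k) ^ ((i : ℕ) * ((i : ℕ) + 1) / 2)) •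
        (e k i * h k (n + 1 - i))

/-- The defining relation of the odd elementary symmetric functions. -/
theorem e_relation (k : Type*) [CommRing k] (n : ℕ) (hn : 1 ≤ n) :
    ∑ i ∈ Finset.range (n + 1), ((-1 : k) ^ (i * (i + 1) / 2)) • (e k i * h k (n - i)) = 0 := by
  obtain ⟨m, rfl⟩ : ∃ m, n = m + 1 := ⟨n - 1, by omega⟩
  have h0 : h k 0 = 1 := by simp [h]
  have hs : ((-1 : k) ^ ((m + 1) * (m + 2) / 2)) * (-1) ^ ((m + 1) * (m + 2) / 2) = 1 := by
    rw [← mul_pow]; simp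
  rw [Finset.sum_range_succ, Finset.sum_range, Nat.sub_self, h0, mul_one]
  rw [e.eq_2 k m, smul_smul, mul_neg, hs, neg_smul, one_smul, add_neg_cancel]

/-- The product `x_{λ_1} x_{λ_2} ⋯ x_{λ_r}` for a partition `λ = (λ_1 ≥ λ_2 ≥ ⋯ ≥ λ_r)`. -/
noncomputable def partProd {k : Type*} [CommRing k] (x : ℕ → QSymFree k) {n : ℕ}
    (l : n.Partition) : QSymFree k :=
  ((l.parts.sort (fun a b => b ≤ a)).map x).prod

end QSymFree

/-- The module `Λ^q = Λ' / I`, the quotient of `Λ'` by the radical `I` of the form. For `q = -1`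
these are the odd symmetric functions. -/
abbrev QSym {k : Type*} [CommRing k] (q : k) : Type _ := QSymFree k ⧸ QSymFree.radical q

namespace QSym

/-- The degree `n` part `Λ^q_n`: the image of `Λ'_n`. -/
noncomputable def degreePart {k : Type*} [CommRing k] (q : k) (n : ℕ) : Submodule k (QSym q) :=
  (QSymFree.degreePart k n).map (QSymFree.radical q).mkQ

/-- The odd complete symmetric function `h_λ` in `Λ`. -/
noncomputable def hPart (k : Type*) [CommRing k] {n : ℕ} (l : n.Partition) : QSym (-1 : k) :=
  (QSymFree.radical (-1 : k)).mkQ (QSymFree.partProd (QSymFree.h k) l)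

/-- The odd elementary symmetric function `e_λ` in `Λ`. -/
noncomputable def ePart (k : Type*) [CommRing k] {n : ℕ} (l : n.Partition) : QSym (-1 : k) :=
  (QSymFree.radical (-1 : k)).mkQ (QSymFree.partProd (QSymFree.e k) l)

end QSym

/-! A double coset in `S_β \ S_n / S_α` is determined by the matrix of its block intersection sizes.
These matrices are exactly the natural-number matrices with row sums `β` and column sums `α`, and
the minimal length is the number of matrix inversions (`sum_cosets`). Peeling off rows shows that
left multiplication by `h_b` has an adjoint `skew q b`, given by a q-twisted Leibniz rule, and that
`(x, y)` is the counit of `adj q x` applied to `y` (`form_apply`). Hence any relation between the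
operators `skew q b` holds, in reversed order, between the `h_b` modulo the radical.

Spanning: at `q = -1` these operators commute in even total degree and satisfy a four-term relation
in odd total degree (`oddRel_skewInt`); at `q = 1` they commute. Either way a product with an ascent
can be rewritten by moving larger letters to the left, so the `h_λ` span.

Independence: `skew q 1` lowers the index of an elementary function by one, and higher `skew q b`
kill it. On a product of elementary functions the largest `skew` that survives removes the first
column of the Young diagram, up to a power of `q`. So the matrix of the pairings of `h_λ` with
`e_μ'`, where `μ'` is the conjugate of `μ`, is triangular in lexicographic order with powers of `q`
on the diagonal, and its determinant is a unit. A spanning family whose pairing matrix with another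
family of the same size is invertible is a basis, and so is the other family. No division is used,
so this works over every commutative ring. -/

namespace QSymFree

open Finset

/-! ### Double cosets as matrices with given margins -/

/-- The matrices of natural numbers with row sums `b` and column sums `a`. -/
def marginMatrices {r m : ℕ} (b : Fin r → ℕ) (a : Fin m → ℕ) : Finset (Fin r → Fin m → ℕ) :=
  (Fintype.piFinset fun i => piAntidiag univ (b i)).filter (fun M => ∀ j, ∑ i, M i j = a j)

theorem mem_marginMatrices {r m : ℕ} {b : Fin r → ℕ} {a : Fin m → ℕ} {M : Fin r → Fin m → ℕ} :
    M ∈ marginMatrices b a ↔ (∀ i, ∑ j, M i j = b i) ∧ ∀ j, ∑ i, M i j = a j := by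
  simp [marginMatrices]

/-- The number of inversions of a matrix, counted with multiplicity. -/
def matrixInv {r m : ℕ} (M : Fin r → Fin m → ℕ) : ℕ :=
  ∑ i, ∑ i', ∑ j, ∑ j', if i < i' ∧ j < j' then M i j' * M i' j else 0

theorem matrixInv_transpose {r m : ℕ} (M : Fin r → Fin m → ℕ) :
    matrixInv (fun j i => M i j) = matrixInv M := by
  unfold matrixInv
  calc _ = ∑ j, ∑ i, ∑ j', ∑ i', if j < j' ∧ i < i' then M i' j * M i j' else 0 := by
        refine sum_congr rfl fun j _ => ?_
        rw [sum_comm]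
    _ = ∑ i, ∑ j, ∑ i', ∑ j', if j < j' ∧ i < i' then M i' j * M i j' else 0 := by
        rw [sum_comm]
        refine sum_congr rfl fun i _ => sum_congr rfl fun j _ => ?_
        rw [sum_comm]
    _ = _ := by
        refine sum_congr rfl fun i _ => ?_
        rw [sum_comm]
        refine sum_congr rfl fun i' _ => sum_congr rfl fun j _ => sum_congr rfl fun j' _ => ?_
        simp only [and_comm, mul_comm]

/-- The matrix counting the points with prescribed values of `u` and `f`. -/
def contingency {n r m : ℕ} (f : Fin n → Fin m) (u : Fin n → Fin r) (i : Fin r) (j : Fin m) : ℕ :=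
  #{p | f p = j ∧ u p = i}

theorem sum_contingency_row {n r m : ℕ} (f : Fin n → Fin m) (u : Fin n → Fin r) (i : Fin r) :
    ∑ j, contingency f u i j = #{p | u p = i} := by
  rw [card_eq_sum_card_fiberwise (f := f) (t := univ) (by simp)]
  refine sum_congr rfl fun j _ => ?_
  rw [contingency, filter_filter]
  simp only [and_comm]

theorem sum_contingency_col {n r m : ℕ} (f : Fin n → Fin m) (u : Fin n → Fin r) (j : Fin m) :
    ∑ i, contingency f u i j = #{p | f p = j} := by
  rw [card_eq_sum_card_fiberwise (f := u) (t := univ) (by simp)]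
  refine sum_congr rfl fun i _ => ?_
  rw [contingency, filter_filter]

theorem contingency_comp_perm {n r m : ℕ} (f : Fin n → Fin m) (u : Fin n → Fin r)
    (b : Equiv.Perm (Fin n)) : contingency (f ∘ b) (u ∘ b) = contingency f u := by
  ext i j
  refine card_bij' (fun p _ => b p) (fun p _ => b.symm p) ?_ ?_ ?_ ?_ <;> simp

/-- The joint fibres of `(f, u)` and `(f, u')` have equal sizes, so bijections between them glue to
a permutation. -/
theorem exists_perm_of_contingency_eq {n r m : ℕ} {f : Fin n → Fin m} {u u' : Fin n → Fin r}
    (h : contingency f u = contingency f u') :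
    ∃ b : Equiv.Perm (Fin n), f ∘ b = f ∧ u ∘ b = u' := by
  have e : ∀ c : Fin m × Fin r, {p // (f p, u' p) = c} ≃ {p // (f p, u p) = c} := by
    rintro ⟨j, i⟩
    refine Fintype.equivOfCardEq ?_
    rw [Fintype.card_subtype, Fintype.card_subtype]
    simpa [contingency] using (congrFun (congrFun h i) j).symm
  refine ⟨Equiv.ofFiberEquiv e, ?_, ?_⟩
  · ext p
    exact congrArg (fun x => (x.1 : Fin m).val) (Equiv.ofFiberEquiv_map e p)
  · ext p
    exact congrArg (fun x => (x.2 : Fin r).val) (Equiv.ofFiberEquiv_map e p)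

theorem exists_contingency_eq {n r m : ℕ} {f : Fin n → Fin m} {g : Fin n → Fin r}
    {M : Fin r → Fin m → ℕ} (hr : ∀ i, ∑ j, M i j = #{p | g p = i})
    (hc : ∀ j, ∑ i, M i j = #{p | f p = j}) :
    ∃ σ : Equiv.Perm (Fin n), contingency f (g ∘ σ) = M := by
  -- `X` has `M i j` points labelled `(i, j)`. Matching its columns with the fibres of `f` and its
  -- rows with the fibres of `g` gives two bijections to `Fin n`, and `σ` compares them.
  let X := Σ x : Fin r × Fin m, Fin (M x.1 x.2)
  have e₁ : ∀ j, {x : X // x.1.2 = j} ≃ {p // f p = j} := by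
    intro j
    refine Fintype.equivOfCardEq ?_
    rw [Fintype.card_subtype (fun p => f p = j), ← hc,
      Fintype.card_congr (β := Σ i, Fin (M i j))]
    · simp
    · exact ⟨fun x => ⟨x.1.1.1, Fin.cast (by rw [x.2]) x.1.2⟩, fun x => ⟨⟨(x.1, j), x.2⟩, rfl⟩,
        by rintro ⟨⟨⟨i, j⟩, t⟩, rfl⟩; rfl, by rintro ⟨i, t⟩; rfl⟩
  have e₂ : ∀ i, {x : X // x.1.1 = i} ≃ {p // g p = i} := by
    intro i
    refine Fintype.equivOfCardEq ?_
    rw [Fintype.card_subtype (fun p => g p = i), ← hr,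
      Fintype.card_congr (β := Σ j, Fin (M i j))]
    · simp
    · exact ⟨fun x => ⟨x.1.1.2, Fin.cast (by rw [x.2]) x.1.2⟩, fun x => ⟨⟨(i, x.1), x.2⟩, rfl⟩,
        by rintro ⟨⟨⟨i, j⟩, t⟩, rfl⟩; rfl, by rintro ⟨i, t⟩; rfl⟩
  obtain ⟨E₁, h₁⟩ : ∃ E : X ≃ Fin n, ∀ x, f (E x) = x.1.2 :=
    ⟨Equiv.ofFiberEquiv e₁, Equiv.ofFiberEquiv_map e₁⟩
  obtain ⟨E₂, h₂⟩ : ∃ E : X ≃ Fin n, ∀ x, g (E x) = x.1.1 :=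
    ⟨Equiv.ofFiberEquiv e₂, Equiv.ofFiberEquiv_map e₂⟩
  refine ⟨E₁.symm.trans E₂, ?_⟩
  ext i j
  have h : #{x : X | x.1 = (i, j)} = M i j := by
    rw [← Fintype.card_subtype, Fintype.card_congr (β := Fin (M i j))]
    · simp
    · exact ⟨fun x => Fin.cast (by rw [x.2]) x.1.2, fun x => ⟨⟨(i, j), x⟩, rfl⟩,
        by rintro ⟨⟨⟨i, j⟩, t⟩, h⟩; cases h; rfl, fun _ => rfl⟩
  rw [← h]
  refine card_equiv E₁.symm fun p => ?_
  obtain ⟨p, rfl⟩ := E₁.surjective p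
  simp [h₁, h₂, Prod.ext_iff, and_comm]

theorem matrixInv_contingency {n r m : ℕ} (f : Fin n → Fin m) (u : Fin n → Fin r) :
    matrixInv (contingency f u) = #{p : Fin n × Fin n | f p.1 < f p.2 ∧ u p.2 < u p.1} := by
  rw [card_eq_sum_card_fiberwise (t := univ)
    (f := fun p : Fin n × Fin n => (u p.2, u p.1, f p.1, f p.2)) (by simp)]
  simp only [Fintype.sum_prod_type, matrixInv]
  refine sum_congr rfl fun i _ => sum_congr rfl fun i' _ => sum_congr rfl fun j _ =>
    sum_congr rfl fun j' _ => ?_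
  split_ifs with h
  · rw [contingency, contingency, mul_comm, ← card_product]
    congr 1
    ext ⟨p, p'⟩
    simp only [mem_product, mem_filter, mem_univ, true_and, Prod.mk.injEq]
    grind
  · symm
    rw [card_eq_zero, filter_eq_empty_iff]
    simp only [mem_filter, mem_univ, true_and, Prod.mk.injEq]
    grind

theorem matrixInv_le_permLength {n r m : ℕ} {f : Fin n → Fin m} {g : Fin n → Fin r}
    (hf : Monotone f) (hg : Monotone g) (σ : Equiv.Perm (Fin n)) :
    matrixInv (contingency f (g ∘ σ)) ≤ permLength σ := by
  rw [matrixInv_contingency]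
  refine card_le_card fun p => ?_
  simp only [mem_filter, mem_univ, true_and]
  exact fun h => ⟨hf.reflect_lt h.1, hg.reflect_lt h.2⟩

/-- The minimal representative: make the word of `g`-labels weakly increasing on every `f`-block,
then standardize it. The only inversions left are the strict ones between different blocks, which
the matrix already forces. -/
theorem exists_permLength_eq_matrixInv {n r m : ℕ} {f : Fin n → Fin m} {g : Fin n → Fin r}
    (hf : Monotone f) (hg : Monotone g) (σ₀ : Equiv.Perm (Fin n)) :
    ∃ σ : Equiv.Perm (Fin n), contingency f (g ∘ σ) = contingency f (g ∘ σ₀) ∧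
      permLength σ = matrixInv (contingency f (g ∘ σ)) := by
  -- The lexicographic key makes `b` preserve `f` and sort the `g`-labels inside each block.
  let b := Tuple.sort (fun p => toLex (f p, g (σ₀ p)))
  have hb : Monotone ((fun p => toLex (f p, g (σ₀ p))) ∘ b) := Tuple.monotone_sort _
  have hfb : f ∘ b = f := by
    have h1 : Monotone (f ∘ b) := by
      intro p p' hp
      exact Prod.Lex.monotone_fst _ _ (hb hp)
    exact Tuple.unique_monotone (f := f) (σ := b) (τ := 1) h1 hf
  let u := g ∘ σ₀ ∘ b
  let τ := Tuple.sort u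
  have hu : u ∘ τ = g := by
    have h1 : Monotone (g ∘ (b.trans σ₀ |> τ.trans)) := Tuple.monotone_sort u
    exact Tuple.unique_monotone (f := g) (τ := 1) h1 hg
  have hgu : g ∘ τ.symm = u := by
    rw [← hu]; ext p; simp
  have hcont : contingency f (g ∘ τ.symm) = contingency f (g ∘ σ₀) := by
    rw [hgu]
    conv_lhs => rw [← hfb]
    exact contingency_comp_perm f (g ∘ σ₀) b
  refine ⟨τ.symm, hcont, le_antisymm ?_ (matrixInv_le_permLength hf hg _)⟩
  rw [matrixInv_contingency]
  refine card_le_card fun ⟨p, p'⟩ => ?_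
  simp only [mem_filter, mem_univ, true_and]
  rintro ⟨hp, hσ⟩
  have hstab := (Tuple.eq_sort_iff (f := u) (σ := τ)).1 rfl
  have hu' : (g ∘ τ.symm) p' < (g ∘ τ.symm) p := by
    -- Stability of the sort: positions with equal labels keep their order, so they cannot be
    -- inverted.
    refine lt_of_le_of_ne (hg hσ.le) fun heq => ?_
    rw [hgu] at heq
    have := hstab.2 (τ.symm p') (τ.symm p) hσ (by simpa using heq)
    simp only [Equiv.apply_symm_apply] at this
    exact absurd hp this.asymm
  refine ⟨lt_of_le_of_ne (hf hp.le) fun heq => ?_, hu'⟩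
  have h2 := hb hp.le
  rw [hgu] at hu'
  rw [Function.comp, Function.comp, Prod.Lex.toLex_le_toLex] at h2
  rw [← hfb] at heq
  rcases h2 with h2 | h2
  · exact h2.ne heq
  · exact absurd hu' (not_lt.2 h2.2)

theorem monotone_index {n : ℕ} (c : Composition n) : Monotone c.index := by
  intro p p' hp
  by_contra! h
  have h1 := c.sizeUpTo_index_le p
  have h2 : (p' : ℕ) < c.sizeUpTo (c.index p').1.succ := c.lt_sizeUpTo_index_succ p'
  have h3 : c.sizeUpTo (c.index p').1.succ ≤ c.sizeUpTo (c.index p).1 :=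
    c.monotone_sizeUpTo h
  have : p.1 ≤ p'.1 := hp
  omega

theorem card_index_eq {n : ℕ} (c : Composition n) (j : Fin c.length) :
    #{p | c.index p = j} = c.blocksFun j := by
  rw [← Fintype.card_fin (c.blocksFun j), ← card_univ, ← card_map (c.embedding j).toEmbedding]
  congr 1
  ext p
  simp only [mem_filter, mem_univ, true_and, mem_map]
  constructor
  · rintro rfl
    exact ⟨c.invEmbedding p, c.embedding_comp_inv p⟩
  · rintro ⟨x, rfl⟩
    exact c.index_embedding j x

theorem doubleCoset_mk_eq_iff {n : ℕ} (β α : Composition n) (σ τ : Equiv.Perm (Fin n)) :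
    (DoubleCoset.mk (parabolic β) (parabolic α) σ : Cosets β α) =
      DoubleCoset.mk (parabolic β) (parabolic α) τ ↔
    contingency α.index (β.index ∘ σ) = contingency α.index (β.index ∘ τ) := by
  rw [DoubleCoset.eq]
  constructor
  · rintro ⟨a, ha, b, hb, rfl⟩
    have hb' : α.index ∘ b = α.index := funext hb
    have : β.index ∘ ⇑(a * σ * b) = (β.index ∘ σ) ∘ b := funext fun p => ha _
    rw [this]
    conv_rhs => rw [← hb']
    rw [contingency_comp_perm]
  · intro h
    obtain ⟨b, hb, hu⟩ := exists_perm_of_contingency_eq h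
    -- The left factor is forced by `τ = a * σ * b`; it preserves the blocks of `β` because `b`
    -- carries the labels of `σ` to those of `τ`.
    refine ⟨τ * b⁻¹ * σ⁻¹, fun p => ?_, b, congrFun hb, by group⟩
    simpa [Equiv.Perm.inv_def] using (congrFun hu (b⁻¹ (σ⁻¹ p))).symm

theorem cosetLength_mk {n : ℕ} (β α : Composition n) (σ : Equiv.Perm (Fin n)) :
    cosetLength (DoubleCoset.mk (parabolic β) (parabolic α) σ : Cosets β α) =
      matrixInv (contingency α.index (β.index ∘ σ)) := by
  obtain ⟨τ, h1, h2⟩ := exists_permLength_eq_matrixInv (monotone_index α) (monotone_index β) σ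
  refine le_antisymm (Nat.sInf_le ⟨τ, (doubleCoset_mk_eq_iff β α τ σ).2 h1, by rw [h2, h1]⟩) ?_
  refine le_csInf ⟨_, σ, rfl, rfl⟩ ?_
  rintro _ ⟨τ', h, rfl⟩
  rw [← (doubleCoset_mk_eq_iff β α τ' σ).1 h]
  exact matrixInv_le_permLength (monotone_index α) (monotone_index β) τ'

theorem sum_cosets {k : Type*} [CommRing k] (q : k) {n : ℕ} (β α : Composition n) :
    ∑ c : Cosets β α, q ^ cosetLength c =
      ∑ M ∈ marginMatrices β.blocksFun α.blocksFun, q ^ matrixInv M := by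
  have hout : ∀ c : Cosets β α, ∃ σ, DoubleCoset.mk (parabolic β) (parabolic α) σ = c :=
    Quotient.mk''_surjective
  choose s hs using hout
  refine sum_bij (fun c _ => contingency α.index (β.index ∘ s c)) ?_ ?_ ?_ ?_
  · intro c _
    rw [mem_marginMatrices]
    refine ⟨fun i => ?_, fun j => ?_⟩
    · rw [sum_contingency_row, ← card_index_eq]
      exact card_bij' (fun p _ => s c p) (fun p _ => (s c).symm p) (by simp) (by simp) (by simp)
        (by simp)
    · rw [sum_contingency_col, card_index_eq]
  · intro c _ c' _ h
    rw [← hs c, ← hs c']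
    exact (doubleCoset_mk_eq_iff β α _ _).2 h
  · intro M hM
    rw [mem_marginMatrices] at hM
    obtain ⟨σ, hσ⟩ := exists_contingency_eq (f := α.index) (g := β.index) (M := M)
      (fun i => by rw [hM.1, card_index_eq]) (fun j => by rw [hM.2, card_index_eq])
    refine ⟨DoubleCoset.mk (parabolic β) (parabolic α) σ, mem_univ _, ?_⟩
    rw [← hσ]
    exact (doubleCoset_mk_eq_iff β α _ _).1 (hs _)
  · intro c _
    conv_lhs => rw [← hs c]
    rw [cosetLength_mk]

theorem marginMatrices_eq_empty {r m : ℕ} {b : Fin r → ℕ} {a : Fin m → ℕ}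
    (h : ∑ i, b i ≠ ∑ j, a j) : marginMatrices b a = ∅ := by
  refine eq_empty_of_forall_notMem fun M hM => h ?_
  rw [mem_marginMatrices] at hM
  simp only [← hM.1, ← hM.2]
  exact sum_comm

end QSymFree

/-! ### Adjoints of multiplication and the twisted Leibniz rule -/

namespace QSymFree

open Finset

variable {k : Type*} [CommRing k]

theorem h_zero : h k 0 = 1 := by simp [h]

theorem h_coe (n : ℕ+) : h k n = FreeAlgebra.ι k n := by
  simp only [h, n.pos, dif_pos]
  rfl

theorem h_mul_induction {N : Submodule k (QSymFree k)} (one : 1 ∈ N)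
    (mul : ∀ (n : ℕ) (y), y ∈ N → h k n * y ∈ N) (x : QSymFree k) : x ∈ N := by
  suffices H : ∀ x y : QSymFree k, y ∈ N → x * y ∈ N by simpa using H x 1 one
  intro x
  induction x using FreeAlgebra.induction with
  | grade0 r => exact fun y hy => by simpa [← Algebra.smul_def] using N.smul_mem r hy
  | grade1 n => exact fun y hy => by simpa [h_coe] using mul n y hy
  | mul a b ha hb => exact fun y hy => by simpa [mul_assoc] using ha _ (hb y hy)
  | add a b ha hb => exact fun y hy => by simpa [add_mul] using N.add_mem (ha y hy) (hb y hy)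

/-- The action of `h_n` on sequences underlying the twisted Leibniz rule. -/
noncomputable def shiftGen (q : k) (n : ℕ) : Module.End k (ℕ → QSymFree k) :=
  LinearMap.pi fun b => ∑ x ∈ antidiagonal b, if x.1 ≤ n then
    q ^ ((n - x.1) * x.2) • (LinearMap.mulLeft k (h k (n - x.1)) ∘ₗ LinearMap.proj x.2) else 0

/-- The action of `Λ'` on sequences underlying the twisted Leibniz rule. -/
noncomputable def shift (q : k) : QSymFree k →ₐ[k] Module.End k (ℕ → QSymFree k) :=
  FreeAlgebra.lift k fun n : ℕ+ => shiftGen q n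

/-- The operator adjoint to left multiplication by `h_b`. -/
noncomputable def skew (q : k) (b : ℕ) : Module.End k (QSymFree k) :=
  LinearMap.proj b ∘ₗ LinearMap.applyₗ (Pi.single 0 1) ∘ₗ (shift q).toLinearMap

theorem shiftGen_apply (q : k) (n : ℕ) (v : ℕ → QSymFree k) (b : ℕ) :
    shiftGen q n v b = ∑ x ∈ antidiagonal b, if x.1 ≤ n then
      q ^ ((n - x.1) * x.2) • (h k (n - x.1) * v x.2) else 0 := by
  simp only [shiftGen, LinearMap.pi_apply, LinearMap.sum_apply]
  refine sum_congr rfl fun x _ => ?_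
  split_ifs <;> simp

theorem shiftGen_zero (q : k) : shiftGen q 0 = 1 := by
  ext1 v
  funext b
  rw [shiftGen_apply, sum_eq_single (0, b)]
  · simp [h_zero]
  · rintro ⟨i, j⟩ hx hne
    rw [if_neg]
    rintro hi
    simp only [HasAntidiagonal.mem_antidiagonal] at hx
    simp only [nonpos_iff_eq_zero] at hi
    subst hi
    simp at hx
    simp [hx] at hne
  · simp

theorem shift_h (q : k) (n : ℕ) : shift q (h k n) = shiftGen q n := by
  rcases Nat.eq_zero_or_pos n with rfl | hn
  · rw [h_zero, map_one, shiftGen_zero]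
  · lift n to ℕ+ using hn
    rw [h_coe, shift, FreeAlgebra.lift_ι_apply]

theorem skew_apply (q : k) (b : ℕ) (x : QSymFree k) : skew q b x = shift q x (Pi.single 0 1) b :=
  rfl

/-- Since `Λ'` is free, this recursion may be prescribed on generators: `skew q b x` is the entry at
`b` of `x` acting on the sequence `(1, 0, 0, …)`. -/
theorem skew_h_mul (q : k) (n b : ℕ) (y : QSymFree k) :
    skew q b (h k n * y) = ∑ x ∈ antidiagonal b, if x.1 ≤ n then
      q ^ ((n - x.1) * x.2) • (h k (n - x.1) * skew q x.2 y) else 0 := by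
  rw [skew_apply, map_mul, Module.End.mul_apply, shift_h, shiftGen_apply]
  rfl

theorem skew_one (q : k) (b : ℕ) : skew q b 1 = if b = 0 then 1 else 0 := by
  rw [skew_apply, map_one, Module.End.one_apply, Pi.single_apply]

theorem skew_zero (q : k) : skew q 0 = 1 := by
  ext1 x
  refine h_mul_induction (N := LinearMap.eqLocus (skew q 0) 1) (by simp [skew_one]) ?_ x
  intro n y hy
  simp only [LinearMap.mem_eqLocus, Module.End.one_apply] at hy ⊢
  simp [skew_h_mul, hy]

theorem skew_h (q : k) (n b : ℕ) : skew q b (h k n) = if b ≤ n then h k (n - b) else 0 := by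
  rw [← mul_one (h k n), skew_h_mul, sum_eq_single (b, 0)]
  · simp [skew_one]
  · rintro ⟨i, j⟩ hx hne
    rw [skew_one, if_neg (c := j = 0)]
    · simp
    · rintro rfl
      simp at hx
      simp [hx] at hne
  · simp

/-- The endomorphism multiplying an element of degree `d` by `c ^ d`. -/
noncomputable def scale (c : k) : QSymFree k →ₐ[k] QSymFree k :=
  FreeAlgebra.lift k fun n : ℕ+ => c ^ (n : ℕ) • h k n

theorem scale_h (c : k) (n : ℕ) : scale c (h k n) = c ^ n • h k n := by
  rcases Nat.eq_zero_or_pos n with rfl | hn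
  · simp [h_zero]
  · lift n to ℕ+ using hn
    rw [h_coe, scale, FreeAlgebra.lift_ι_apply, h_coe]

theorem sum_antidiagonal_assoc {M : Type*} [AddCommMonoid M] (b : ℕ) (F : ℕ → ℕ → ℕ → M) :
    ∑ x ∈ antidiagonal b, ∑ y ∈ antidiagonal x.2, F x.1 y.1 y.2 =
      ∑ x ∈ antidiagonal b, ∑ y ∈ antidiagonal x.1, F y.1 y.2 x.2 := by
  rw [sum_sigma', sum_sigma']
  refine sum_nbij' (fun z => ⟨(z.1.1 + z.2.1, z.2.2), (z.1.1, z.2.1)⟩)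
    (fun z => ⟨(z.2.1, z.2.2 + z.1.2), (z.2.2, z.1.2)⟩) ?_ ?_ ?_ ?_ ?_
  · rintro ⟨⟨a, b⟩, ⟨c, d⟩⟩ h
    simp only [mem_sigma, HasAntidiagonal.mem_antidiagonal, and_true] at h ⊢
    omega
  · rintro ⟨⟨a, b⟩, ⟨c, d⟩⟩ h
    simp only [mem_sigma, HasAntidiagonal.mem_antidiagonal, and_true] at h ⊢
    omega
  · rintro ⟨⟨a, b⟩, ⟨c, d⟩⟩ h
    simp only [mem_sigma, HasAntidiagonal.mem_antidiagonal] at h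
    obtain ⟨-, rfl⟩ := h
    rfl
  · rintro ⟨⟨a, b⟩, ⟨c, d⟩⟩ h
    simp only [mem_sigma, HasAntidiagonal.mem_antidiagonal] at h
    obtain ⟨-, rfl⟩ := h
    rfl
  · rintro ⟨⟨a, b⟩, ⟨c, d⟩⟩ -
    rfl

/-- The full Leibniz rule. Moving `skew q l` past an element of degree `d` costs `q ^ (l * d)`,
which `scale (q ^ l)` records without choosing homogeneous components. -/
theorem skew_mul (q : k) (b : ℕ) (x y : QSymFree k) :
    skew q b (x * y) = ∑ z ∈ antidiagonal b, scale (q ^ z.2) (skew q z.1 x) * skew q z.2 y := by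
  let R (b : ℕ) : QSymFree k →ₗ[k] QSymFree k := ∑ z ∈ antidiagonal b,
    (LinearMap.mulRight k (skew q z.2 y) ∘ₗ (scale (q ^ z.2)).toLinearMap ∘ₗ skew q z.1)
  have hR : ∀ b x, R b x =
      ∑ z ∈ antidiagonal b, scale (q ^ z.2) (skew q z.1 x) * skew q z.2 y := by
    intro b x
    simp [R, LinearMap.sum_apply]
  let N : Submodule k (QSymFree k) :=
    ⨅ b, LinearMap.eqLocus (skew q b ∘ₗ LinearMap.mulRight k y) (R b)
  have hN : ∀ x, x ∈ N ↔ ∀ b, skew q b (x * y) = R b x := by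
    intro x
    simp [N, Submodule.mem_iInf, LinearMap.mem_eqLocus]
  rw [← hR]
  refine (hN x).1 (h_mul_induction (N := N) ?_ ?_ x) b
  · rw [hN]
    intro b
    rw [hR, one_mul, sum_eq_single (0, b)]
    · simp [skew_one]
    · rintro ⟨i, j⟩ hx hne
      rw [skew_one, if_neg]
      · simp
      · rintro rfl
        simp at hx
        simp [hx] at hne
    · simp
  · intro n x hx
    rw [hN] at hx ⊢
    intro b
    rw [mul_assoc, skew_h_mul, hR]
    have h1 : ∀ z ∈ antidiagonal b, (if z.1 ≤ n then
        q ^ ((n - z.1) * z.2) • (h k (n - z.1) * skew q z.2 (x * y)) else 0) =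
        ∑ w ∈ antidiagonal z.2, if z.1 ≤ n then q ^ ((n - z.1) * (w.1 + w.2)) •
          (h k (n - z.1) * (scale (q ^ w.2) (skew q w.1 x) * skew q w.2 y)) else 0 := by
      intro z _
      split_ifs
      · rw [hx, hR, mul_sum, smul_sum]
        refine sum_congr rfl fun w hw => ?_
        rw [HasAntidiagonal.mem_antidiagonal.1 hw]
      · simp
    rw [sum_congr rfl h1, sum_antidiagonal_assoc b fun i j l => if i ≤ n then
      q ^ ((n - i) * (j + l)) •
        (h k (n - i) * (scale (q ^ l) (skew q j x) * skew q l y)) else 0]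
    refine sum_congr rfl fun z _ => ?_
    rw [skew_h_mul, map_sum, sum_mul]
    refine sum_congr rfl fun w _ => ?_
    split_ifs
    · rw [map_smul, map_mul, scale_h, smul_mul_assoc, smul_mul_assoc, smul_mul_assoc, smul_smul,
        ← pow_mul, ← pow_add, mul_assoc]
      congr 2
      ring
    · simp

/-! ### The form expressed through the adjoints -/

/-- The map sending `x` to the adjoint of left multiplication by `x`. -/
noncomputable def adj (q : k) : QSymFree k →ₐ[k] (Module.End k (QSymFree k))ᵐᵒᵖ :=
  FreeAlgebra.lift k fun n : ℕ+ => MulOpposite.op (skew q n)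

theorem adj_h (q : k) (n : ℕ) : adj q (h k n) = MulOpposite.op (skew q n) := by
  rcases Nat.eq_zero_or_pos n with rfl | hn
  · simp [h_zero, skew_zero]
  · lift n to ℕ+ using hn
    rw [h_coe, adj, FreeAlgebra.lift_ι_apply]

/-- The counit of `Λ'`. -/
noncomputable abbrev counit : QSymFree k →ₐ[k] k := FreeAlgebra.algebraMapInv

theorem counit_h (n : ℕ) : counit (h k n) = if n = 0 then 1 else 0 := by
  rcases Nat.eq_zero_or_pos n with rfl | hn
  · simp [h_zero]
  · lift n to ℕ+ using hn
    rw [h_coe, counit, FreeAlgebra.algebraMapInv, FreeAlgebra.lift_ι_apply]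
    simp

/-- The word `h_{a_0} h_{a_1} ⋯` attached to a tuple of natural numbers. -/
noncomputable def hProd {m : ℕ} (a : Fin m → ℕ) : QSymFree k :=
  (List.ofFn fun j => h k (a j)).prod

theorem hProd_succ {m : ℕ} (a : Fin (m + 1) → ℕ) :
    (hProd a : QSymFree k) = h k (a 0) * hProd (Fin.tail a) := by
  simp [hProd, List.ofFn_succ, Fin.tail]

/-- The exponent of `q` contributed by removing the row `u` from column sums `a`. -/
def rowInv {m : ℕ} (u a : Fin m → ℕ) : ℕ :=
  ∑ j, ∑ j', if j < j' then (a j - u j) * u j' else 0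

theorem rowInv_succ {m : ℕ} (u a : Fin (m + 1) → ℕ) :
    rowInv u a = (a 0 - u 0) * ∑ j, Fin.tail u j + rowInv (Fin.tail u) (Fin.tail a) := by
  simp [rowInv, Fin.sum_univ_succ, Fin.tail, mul_sum]

/-- The tuple `u` is the first row of a matrix with column sums `a`: `skew q b` takes `u j` from the
letter `a j`, and the exponent counts inversions between this row and all rows below it. The bound
`u j ≤ a j` keeps the natural subtraction exact. -/
theorem skew_hProd (q : k) {m : ℕ} (b : ℕ) (a : Fin m → ℕ) :
    skew q b (hProd a) = ∑ u ∈ piAntidiag univ b with ∀ j, u j ≤ a j, q ^ rowInv u a • hProd (a - u) := by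
  induction m generalizing b with
  | zero =>
    rcases Nat.eq_zero_or_pos b with rfl | hb
    · have : (piAntidiag univ 0).filter (fun u : Fin 0 → ℕ => ∀ j, u j ≤ a j) = {0} := by
        ext u
        simp [Subsingleton.elim u 0, Subsingleton.elim a 0]
      rw [this, sum_singleton]
      simp [rowInv, hProd, skew_one]
    · have : (piAntidiag univ b).filter (fun u : Fin 0 → ℕ => ∀ j, u j ≤ a j) = ∅ := by
        ext u
        simp [hb.ne]
      rw [this, sum_empty]
      simp [hProd, skew_one, hb.ne']
  | succ m ih =>
    rw [hProd_succ, skew_h_mul, ← sum_filter]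
    simp_rw [ih, mul_sum, smul_sum]
    rw [sum_sigma']
    refine sum_nbij' (fun z => Fin.cons z.1.1 z.2)
      (fun u => ⟨(u 0, ∑ j, Fin.tail u j), Fin.tail u⟩) ?_ ?_ ?_ ?_ ?_
    · rintro ⟨⟨i, c⟩, u⟩ hz
      simp only [mem_sigma, mem_filter, HasAntidiagonal.mem_antidiagonal, mem_piAntidiag, mem_univ, implies_true,
        and_true] at hz ⊢
      obtain ⟨⟨h1, h2⟩, h3, h4⟩ := hz
      refine ⟨by simp [Fin.sum_univ_succ, h3, h1], ?_⟩
      intro j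
      refine Fin.cases ?_ (fun j => ?_) j
      · simpa using h2
      · simpa [Fin.tail] using h4 j
    · rintro u hz
      simp only [mem_sigma, mem_filter, HasAntidiagonal.mem_antidiagonal, mem_piAntidiag, mem_univ, implies_true,
        and_true] at hz ⊢
      obtain ⟨h1, h2⟩ := hz
      rw [Fin.sum_univ_succ] at h1
      exact ⟨⟨h1, h2 0⟩, trivial, fun j => h2 j.succ⟩
    · rintro ⟨⟨i, c⟩, u⟩ hz
      simp only [mem_sigma, mem_filter, HasAntidiagonal.mem_antidiagonal, mem_piAntidiag, mem_univ, implies_true,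
        and_true] at hz
      simp [hz.2.1]
    · intro u _
      simp
    · rintro ⟨⟨i, c⟩, u⟩ hz
      simp only [mem_sigma, mem_filter, HasAntidiagonal.mem_antidiagonal, mem_piAntidiag, mem_univ, implies_true,
        and_true] at hz
      rw [rowInv_succ, hProd_succ, mul_smul_comm, smul_smul, ← pow_add]
      simp [Fin.tail_cons, hz.2.1]
      rfl

theorem matrixInv_cons {r m : ℕ} (u : Fin m → ℕ) (M : Fin r → Fin m → ℕ) :
    matrixInv (Fin.cons (α := fun _ => Fin m → ℕ) u M) =
      rowInv u (u + fun j => ∑ i, M i j) + matrixInv M := by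
  simp only [matrixInv, rowInv, Fin.sum_univ_succ, Fin.cons_zero, Fin.cons_succ,
    false_and, if_false, sum_const_zero, zero_add, Fin.succ_pos, true_and, Fin.not_lt_zero,
    Fin.succ_lt_succ_iff, Pi.add_apply, Nat.add_sub_cancel_left]
  congr 1
  rw [sum_comm]
  refine sum_congr rfl fun j _ => ?_
  rw [sum_comm]
  refine sum_congr rfl fun j' _ => ?_
  split_ifs
  · rw [sum_mul]
    exact sum_congr rfl fun i _ => mul_comm _ _
  · simp

theorem counit_adj_hProd (q : k) {r m : ℕ} (b : Fin r → ℕ) (a : Fin m → ℕ) :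
    counit ((adj q (hProd b)).unop (hProd a)) = ∑ M ∈ marginMatrices b a, q ^ matrixInv M := by
  induction r generalizing a with
  | zero =>
    have h1 : (hProd b : QSymFree k) = 1 := by simp [hProd]
    have h2 : counit (hProd a : QSymFree k) = if a = 0 then 1 else 0 := by
      rw [hProd, map_list_prod, List.map_ofFn, List.prod_ofFn]
      simp only [Function.comp, counit_h]
      rw [Fintype.prod_ite_zero]
      simp [funext_iff]
    rw [h1, map_one, MulOpposite.unop_one, Module.End.one_apply, h2]
    split_ifs with ha
    · have : marginMatrices b a = {fun i => i.elim0} := by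
        ext M
        simp [mem_marginMatrices, ha, Subsingleton.elim M (fun i => i.elim0)]
      simp [this, matrixInv]
    · have : marginMatrices b a = ∅ := by
        refine eq_empty_of_forall_notMem fun M hM => ha ?_
        rw [mem_marginMatrices] at hM
        ext j
        simpa using (hM.2 j).symm
      simp [this]
  | succ r ih =>
    rw [hProd_succ, map_mul, adj_h, MulOpposite.unop_mul, MulOpposite.unop_op,
      Module.End.mul_apply, skew_hProd, map_sum, map_sum]
    simp_rw [map_smul, ih, smul_eq_mul, mul_sum]
    rw [sum_sigma']
    refine sum_nbij' (fun z => Fin.cons (α := fun _ => Fin m → ℕ) z.1 z.2)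
      (fun M => ⟨M 0, Fin.tail M⟩) ?_ ?_ ?_ ?_ ?_
    · rintro ⟨u, M⟩ hz
      simp only [mem_sigma, mem_filter, mem_piAntidiag, mem_univ, implies_true,
        and_true, mem_marginMatrices] at hz ⊢
      obtain ⟨⟨h1, h2⟩, h3, h4⟩ := hz
      refine ⟨fun i => ?_, fun j => ?_⟩
      · refine Fin.cases ?_ (fun i => ?_) i
        · simpa using h1
        · simpa [Fin.tail] using h3 i
      · have := h2 j
        have := h4 j
        simp only [Fin.sum_univ_succ, Fin.cons_zero, Fin.cons_succ, Pi.sub_apply] at *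
        omega
    · intro M hM
      simp only [mem_sigma, mem_filter, mem_piAntidiag, mem_univ, implies_true,
        and_true, mem_marginMatrices, Pi.sub_apply] at hM ⊢
      obtain ⟨h1, h2⟩ := hM
      simp only [Fin.sum_univ_succ (n := r)] at h2
      refine ⟨⟨h1 0, fun j => ?_⟩, fun i => h1 i.succ, fun j => ?_⟩
      · have := h2 j
        omega
      · have := h2 j
        simp only [Fin.tail]
        omega
    · rintro ⟨u, M⟩ _
      simp
    · intro M _
      simp
    · rintro ⟨u, M⟩ hz
      simp only [mem_sigma, mem_filter, mem_piAntidiag, mem_univ, implies_true,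
        and_true, mem_marginMatrices] at hz
      obtain ⟨⟨h1, h2⟩, h3, h4⟩ := hz
      have : (u + fun j => ∑ i, M i j) = a := by
        ext j
        have := h2 j
        have := h4 j
        simp only [Pi.add_apply, Pi.sub_apply] at *
        omega
      rw [matrixInv_cons, this, pow_add]

theorem basis_eq_prod (w : FreeMonoid ℕ+) : FreeAlgebra.basisFreeMonoid k ℕ+ w =
    ((FreeMonoid.toList w).map fun a : ℕ+ => h k a).prod := by
  have : FreeAlgebra.basisFreeMonoid k ℕ+ w = FreeMonoid.lift (FreeAlgebra.ι k) w := by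
    simp [FreeAlgebra.basisFreeMonoid, FreeAlgebra.equivMonoidAlgebraFreeMonoid]
  rw [this, FreeMonoid.lift_apply]
  simp [h_coe]

theorem basis_eq_hProd {n : ℕ} (w : FreeMonoid ℕ+) (hw : wordDegree w = n) :
    FreeAlgebra.basisFreeMonoid k ℕ+ w = hProd (wordComposition w hw).blocksFun := by
  rw [basis_eq_prod, hProd]
  congr 1
  refine List.ext_getElem ?_ ?_
  · simp [wordComposition, Composition.length]
  · intro i h1 h2
    simp [Composition.blocksFun, wordComposition]

theorem wordForm_eq (q : k) (β α : FreeMonoid ℕ+) : wordForm q β α =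
    ∑ M ∈ marginMatrices (wordComposition β rfl).blocksFun (wordComposition α rfl).blocksFun,
      q ^ matrixInv M := by
  have key : ∀ n (hdeg : wordDegree α = n),
      ∑ M ∈ marginMatrices (wordComposition β rfl).blocksFun (wordComposition α hdeg).blocksFun,
        q ^ matrixInv M =
      ∑ M ∈ marginMatrices (wordComposition β rfl).blocksFun (wordComposition α rfl).blocksFun,
      q ^ matrixInv M := by
    rintro n rfl
    rfl
  unfold wordForm
  split_ifs with hdeg
  · rw [sum_cosets, key]
  · rw [marginMatrices_eq_empty, sum_empty]
    rw [Composition.sum_blocksFun, Composition.sum_blocksFun]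
    exact fun h => hdeg h.symm

/-- Both sides are bilinear and agree on words, where each is the inversion generating function of
the same matrices. -/
theorem form_apply (q : k) (x y : QSymFree k) : form q x y = counit ((adj q x).unop y) := by
  let B : LinearMap.BilinForm k (QSymFree k) := LinearMap.mk₂ k
    (fun x y => counit ((adj q x).unop y)) (by simp) (by simp) (by simp) (by simp)
  suffices form q = B by rw [this]; rfl
  refine (FreeAlgebra.basisFreeMonoid k ℕ+).ext fun β =>
    (FreeAlgebra.basisFreeMonoid k ℕ+).ext fun α => ?_
  rw [form, Module.Basis.constr_basis, Module.Basis.constr_basis, wordForm_eq]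
  change _ = counit _
  rw [basis_eq_hProd β rfl, basis_eq_hProd α rfl, counit_adj_hProd]

theorem marginMatrices_sum_comm (q : k) {r m : ℕ} (b : Fin r → ℕ) (a : Fin m → ℕ) :
    ∑ M ∈ marginMatrices b a, q ^ matrixInv M = ∑ M ∈ marginMatrices a b, q ^ matrixInv M := by
  refine sum_nbij' (fun M j i => M i j) (fun M j i => M i j) ?_ ?_ ?_ ?_ ?_
  · exact fun M hM => mem_marginMatrices.2 (mem_marginMatrices.1 hM).symm
  · exact fun M hM => mem_marginMatrices.2 (mem_marginMatrices.1 hM).symm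
  · exact fun _ _ => rfl
  · exact fun _ _ => rfl
  · exact fun M _ => by rw [matrixInv_transpose]

theorem form_comm (q : k) (x y : QSymFree k) : form q x y = form q y x := by
  suffices form q = LinearMap.flip (form q) by
    conv_lhs => rw [this]
    rfl
  refine (FreeAlgebra.basisFreeMonoid k ℕ+).ext fun β =>
    (FreeAlgebra.basisFreeMonoid k ℕ+).ext fun α => ?_
  rw [LinearMap.flip_apply, form_apply, form_apply, basis_eq_hProd β rfl, basis_eq_hProd α rfl,
    counit_adj_hProd, counit_adj_hProd, marginMatrices_sum_comm]

end QSymFree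

/-! ### The quadratic relations at `q = -1` -/

namespace QSymFree

open Finset

section OddRelations

variable {V : Type*} [AddCommGroup V]

/-- The difference whose symmetry expresses the odd quadratic relations in odd degree. -/
def twistedDiff (P : ℤ → ℤ → V) (u v : ℤ) : V := P u v - u.negOnePow • P (u + 1) (v - 1)

/-- The quadratic relations between the odd complete symmetric functions. -/
structure OddRel (P : ℤ → ℤ → V) : Prop where
  symm : ∀ u v, Even (u + v) → P u v = P v u
  twist : ∀ u v, Odd (u + v) → twistedDiff P u v = twistedDiff P (v - 1) (u + 1)

/-- The sign in `convolve`. -/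
def convolveSign (n s j a b : ℤ) : ℤˣ := ((n - j) * (b - j) + (n - s) * (a - s + j)).negOnePow

/-- The signed sum of `P` over the ways of lowering both indices by `s` in total. -/
def convolve (P : ℤ → ℤ → V) (n : ℤ) (s : ℕ) (a b : ℤ) : V :=
  ∑ j ∈ range (s + 1), convolveSign n s j a b • P (a - s + j) (b - j)

theorem sum_range_two_mul (f : ℕ → V) (t : ℕ) :
    ∑ j ∈ range (2 * t), f j = ∑ i ∈ range t, (f (2 * i) + f (2 * i + 1)) := by
  induction t with
  | zero => simp
  | succ t ih => rw [mul_add, mul_one, sum_range_succ, sum_range_succ, ih, sum_range_succ, add_assoc]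

theorem negOnePow_congr {a b : ℤ} (h : Even a ↔ Even b) : a.negOnePow = b.negOnePow := by
  rw [Int.negOnePow_eq_iff, Int.even_sub]
  exact h

theorem twistedDiff_convolve (P : ℤ → ℤ → V) (n : ℤ) (s : ℕ) (a b : ℤ) :
    twistedDiff (convolve P n s) a b =
      ∑ j ∈ range (s + 1), convolveSign n s j a b • twistedDiff P (a - s + j) (b - j) := by
  simp only [twistedDiff, convolve, smul_sum, ← sum_sub_distrib, smul_sub, smul_smul]
  refine sum_congr rfl fun j _ => ?_
  congr 2
  · rw [convolveSign, convolveSign, ← Int.negOnePow_add, ← Int.negOnePow_add]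
    apply negOnePow_congr
    simp only [Int.even_add, Int.even_sub, Int.even_mul, Int.not_even_one]
    grind
  · congr 1 <;> ring

/-- An odd shift exchanges the two kinds of relation. Here consecutive summands pair into twisted
differences of odd total degree, so the symmetry of `convolve` comes from `twist`;
`twistedDiff_convolve_odd` gives the reverse exchange. -/
theorem convolve_odd (P : ℤ → ℤ → V) (n : ℤ) (t : ℕ) (a b : ℤ) (hab : Even (a + b)) :
    convolve P n (2 * t + 1) a b = (n + 1 + b).negOnePow •
      ∑ i ∈ range (t + 1), twistedDiff P (a - (2 * t + 1) + 2 * i) (b - 2 * i) := by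
  rw [convolve, show 2 * t + 1 + 1 = 2 * (t + 1) by ring, sum_range_two_mul, smul_sum]
  refine sum_congr rfl fun i _ => ?_
  rw [twistedDiff, smul_sub, smul_smul, sub_eq_add_neg (_ • _), ← Units.neg_smul]
  rw [Int.even_add] at hab
  push_cast
  congr 1
  · congr 1
    apply negOnePow_congr
    simp only [Int.even_add, Int.even_sub, Int.even_mul, Int.not_even_one, even_two]
    grind
  · congr 1
    · rw [← Int.negOnePow_add, ← Int.negOnePow_succ]
      apply negOnePow_congr
      simp only [Int.even_add, Int.even_sub, Int.even_mul, Int.not_even_one, even_two]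
      grind
    · congr 1 <;> ring

theorem twistedDiff_convolve_odd (P : ℤ → ℤ → V) (n : ℤ) (t : ℕ) (a b : ℤ) (hab : Odd (a + b)) :
    twistedDiff (convolve P n (2 * t + 1)) a b = b.negOnePow •
      ∑ i ∈ range (t + 1), (P (a - (2 * t + 1) + 2 * i) (b - 2 * i) +
        P (a - (2 * t + 1) + 2 * i + 2) (b - 2 * i - 2)) := by
  rw [twistedDiff_convolve, show 2 * t + 1 + 1 = 2 * (t + 1) by ring, sum_range_two_mul, smul_sum]
  refine sum_congr rfl fun i _ => ?_
  rw [← Int.not_even_iff_odd, Int.even_add] at hab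
  have h1 : convolveSign n (2 * t + 1 : ℕ) (2 * i : ℕ) a b = b.negOnePow := by
    apply negOnePow_congr
    push_cast
    simp only [Int.even_add, Int.even_sub, Int.even_mul, Int.not_even_one, even_two]
    grind
  have h2 : convolveSign n (2 * t + 1 : ℕ) (2 * i + 1 : ℕ) a b = 1 := by
    rw [← Int.negOnePow_zero]
    apply negOnePow_congr
    push_cast
    simp only [Int.even_add, Int.even_sub, Int.even_mul, Int.not_even_one, even_two, Even.zero]
    grind
  have h3 : (a - (2 * t + 1) + 2 * i : ℤ).negOnePow = b.negOnePow := by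
    apply negOnePow_congr
    simp only [Int.even_add, Int.even_sub, Int.even_mul, Int.not_even_one, even_two]
    grind
  have h4 : (a - (2 * t + 1) + 2 * i + 1 : ℤ).negOnePow = - b.negOnePow := by
    rw [Int.negOnePow_succ, h3]
  rw [h1, h2, twistedDiff, twistedDiff]
  push_cast
  rw [h3, show (a - (2 * t + 1) + (2 * i + 1) : ℤ) = a - (2 * t + 1) + 2 * i + 1 by ring, h4,
    smul_sub, smul_smul, ← Int.negOnePow_add, Int.negOnePow_even _ (by simp : Even (b + b)),
    show (b - (2 * i + 1) : ℤ) = b - 2 * i - 1 by ring, smul_add,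
    show (a - (2 * t + 1) + 2 * i + 1 + 1 : ℤ) = a - (2 * t + 1) + 2 * i + 2 by ring,
    show (b - 2 * i - 1 - 1 : ℤ) = b - 2 * i - 2 by ring, one_smul, one_smul, Units.neg_smul]
  abel

/-- The involution `(u, v) ↦ (v, u)` in even degree, or `(u, v) ↦ (v - 1, u + 1)` in odd degree,
permutes the summands by reversing the summation index. For even `s` each summand satisfies the
required relation itself; for odd `s` the two relations trade places. -/
theorem OddRel.convolve {P : ℤ → ℤ → V} (hP : OddRel P) (n : ℤ) (s : ℕ) :
    OddRel (convolve P n s) := by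
  constructor
  · intro a b hab
    rcases Nat.even_or_odd' s with ⟨t, rfl | rfl⟩
    · rw [QSymFree.convolve, QSymFree.convolve,
        ← sum_flip (f := fun j : ℕ => convolveSign n _ j b a • P _ _)]
      refine sum_congr rfl fun j hj => ?_
      have hj' : j ≤ 2 * t := by simpa [Nat.lt_succ_iff] using hj
      rw [Nat.cast_sub hj', hP.symm]
      · congr 1
        · apply negOnePow_congr
          rw [Int.even_add] at hab
          push_cast
          simp only [Int.even_add, Int.even_sub, Int.even_mul, even_two]
          grind
        · congr 1 <;> ring
      · rw [Int.even_add] at hab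
        push_cast
        simp only [Int.even_add, Int.even_sub, Int.even_mul, even_two]
        grind
    · rw [convolve_odd _ _ _ _ _ hab, convolve_odd _ _ _ _ _ (by rwa [add_comm])]
      congr 1
      · apply negOnePow_congr
        rw [Int.even_add] at hab
        simp only [Int.even_add, hab]
      · rw [← sum_flip]
        refine sum_congr rfl fun i hi => ?_
        have hi' : i ≤ t := by simpa [Nat.lt_succ_iff] using hi
        rw [Nat.cast_sub hi', hP.twist]
        · congr 1 <;> ring
        · rw [← Int.not_even_iff_odd]
          rw [Int.even_add] at hab
          simp only [Int.even_add, Int.even_sub, Int.even_mul, even_two, Int.not_even_one]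
          grind
  · intro a b hab
    rcases Nat.even_or_odd' s with ⟨t, rfl | rfl⟩
    · rw [twistedDiff_convolve, twistedDiff_convolve,
        ← sum_flip (f := fun j : ℕ => convolveSign n _ j (b - 1) _ • twistedDiff P _ _)]
      rw [← Int.not_even_iff_odd, Int.even_add] at hab
      refine sum_congr rfl fun j hj => ?_
      have hj' : j ≤ 2 * t := by simpa [Nat.lt_succ_iff] using hj
      rw [Nat.cast_sub hj', hP.twist]
      · congr 1
        · apply negOnePow_congr
          push_cast
          simp only [Int.even_add, Int.even_sub, Int.even_mul, even_two, Int.not_even_one]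
          grind
        · congr 1 <;> ring
      · rw [← Int.not_even_iff_odd]
        push_cast
        simp only [Int.even_add, Int.even_sub, Int.even_mul, even_two]
        grind
    · rw [twistedDiff_convolve_odd _ _ _ _ _ hab, twistedDiff_convolve_odd]
      · rw [← Int.not_even_iff_odd, Int.even_add] at hab
        congr 1
        · apply negOnePow_congr
          simp only [Int.even_add, Int.not_even_one]
          grind
        · conv_rhs => rw [← sum_flip]
          refine sum_congr rfl fun i hi => ?_
          have hi' : i ≤ t := by simpa [Nat.lt_succ_iff] using hi
          rw [Nat.cast_sub hi', add_comm, hP.symm, hP.symm (a - (2 * t + 1) + 2 * i)]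
          · congr 2 <;> ring
          all_goals
            simp only [Int.even_add, Int.even_sub, Int.even_mul, even_two, Int.not_even_one]
            grind
      · rw [← Int.not_even_iff_odd, Int.even_add] at *
        simp only [Int.even_sub, Int.even_add, Int.not_even_one]
        grind

end OddRelations

variable {k : Type*} [CommRing k]

/-- The operators `skew (-1) b`, extended by zero to negative `b`. -/
noncomputable def skewInt (k : Type*) [CommRing k] (b : ℤ) : Module.End k (QSymFree k) :=
  if 0 ≤ b then skew (-1) b.toNat else 0

theorem skewInt_natCast (b : ℕ) : skewInt k b = skew (-1) b := by simp [skewInt]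

theorem skewInt_of_neg {b : ℤ} (hb : b < 0) : skewInt k b = 0 := by simp [skewInt, hb]

theorem neg_one_pow_smul {M : Type*} [AddCommGroup M] [Module k M] (n : ℕ) (x : M) :
    (-1 : k) ^ n • x = (n : ℤ).negOnePow • x := by
  rcases Nat.even_or_odd n with h | h
  · rw [h.neg_one_pow, Int.negOnePow_even _ (by exact_mod_cast h), one_smul, one_smul]
  · rw [h.neg_one_pow, Int.negOnePow_odd _ (by exact_mod_cast h), neg_smul, Units.neg_smul, one_smul,
      one_smul]

/-- Extension by zero to negative indices makes the summation range independent of `b`, so the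
relations need no boundary cases. -/
theorem skewInt_h_mul (n : ℕ) (b : ℤ) (y : QSymFree k) :
    skewInt k b (h k n * y) = ∑ j ∈ range (n + 1),
      (((n : ℤ) - j) * (b - j)).negOnePow • (h k (n - j) * skewInt k (b - j) y) := by
  rcases lt_or_ge b 0 with hb | hb
  · rw [skewInt_of_neg hb, sum_eq_zero]
    · simp
    · intro j _
      rw [skewInt_of_neg (by omega)]
      simp
  · lift b to ℕ using hb
    rw [skewInt_natCast, skew_h_mul, Nat.sum_antidiagonal_eq_sum_range_succ_mk, ← sum_filter]
    have h1 : {i ∈ range b.succ | i ≤ n} ⊆ range (n + 1) := by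
      intro i
      simp only [mem_filter, mem_range]
      omega
    rw [← sum_subset h1]
    · refine sum_congr rfl fun i hi => ?_
      simp only [mem_filter, mem_range] at hi
      rw [neg_one_pow_smul, ← Nat.cast_sub hi.2, ← Nat.cast_sub (by omega), skewInt_natCast,
        Nat.cast_mul]
    · intro i hi hi'
      simp only [mem_filter, mem_range] at hi hi'
      rw [skewInt_of_neg (by omega)]
      simp

/-- Collecting terms by the total amount `s` taken from `h n` turns the effect of multiplication by
`h n` into `convolve`. This is the induction step for `oddRel_skewInt`. -/
theorem skewInt_skewInt_h_mul (n : ℕ) (a b : ℤ) (y : QSymFree k) :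
    skewInt k a (skewInt k b (h k n * y)) = ∑ s ∈ range (n + 1),
      h k (n - s) * convolve (fun u v => skewInt k u (skewInt k v y)) n s a b := by
  let f : ℕ → ℕ → QSymFree k := fun j i => (((n : ℤ) - j) * (b - j)).negOnePow •
    ((((n : ℤ) - j - i) * (a - i)).negOnePow •
      (h k (n - j - i) * skewInt k (a - i) (skewInt k (b - j) y)))
  trans ∑ m ∈ range (n + 1), ∑ j ∈ range (n + 1 - m), f m j
  · rw [skewInt_h_mul, map_sum]
    refine sum_congr rfl fun j hj => ?_
    have hj' : j ≤ n := by simpa [Nat.lt_succ_iff] using hj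
    rw [Units.smul_def, map_zsmul, skewInt_h_mul, smul_sum, Nat.sub_add_comm hj']
    refine sum_congr rfl fun i _ => ?_
    rw [Nat.cast_sub hj']
    rfl
  · rw [← sum_range_diag_flip]
    refine sum_congr rfl fun s hs => ?_
    rw [convolve, mul_sum]
    refine sum_congr rfl fun j hj => ?_
    have hj' : j ≤ s := by simpa [Nat.lt_succ_iff] using hj
    simp only [f]
    rw [smul_smul, ← Int.negOnePow_add, Nat.cast_sub hj', convolveSign, mul_smul_comm,
      show n - j - (s - j) = n - s by omega,
      show (n : ℤ) - j - (s - j) = n - s by ring, show a - (s - j : ℤ) = a - s + j by ring]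

theorem OddRel.mul_sum {P : ℕ → ℤ → ℤ → QSymFree k} {t : Finset ℕ} (x : ℕ → QSymFree k)
    (hP : ∀ s, OddRel (P s)) : OddRel (fun a b => ∑ s ∈ t, x s * P s a b) := by
  constructor
  · intro u v huv
    exact sum_congr rfl fun s _ => by rw [(hP s).symm u v huv]
  · intro u v huv
    have : ∀ u v, twistedDiff (fun a b => ∑ s ∈ t, x s * P s a b) u v =
        ∑ s ∈ t, x s * twistedDiff (P s) u v := by
      intro u v
      simp [twistedDiff, smul_sum, mul_sub, mul_smul_comm]
    rw [this, this]
    exact sum_congr rfl fun s _ => by rw [(hP s).twist u v huv]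

theorem skewInt_one (b : ℤ) : skewInt k b 1 = if b = 0 then 1 else 0 := by
  rcases lt_or_ge b 0 with hb | hb
  · rw [skewInt_of_neg hb, if_neg hb.ne, LinearMap.zero_apply]
  · lift b to ℕ using hb
    rw [skewInt_natCast, skew_one]
    simp

theorem oddRel_skewInt (y : QSymFree k) :
    OddRel fun u v => skewInt k u (skewInt k v y) := by
  let N : Submodule k (QSymFree k) :=
    { carrier := {y | OddRel fun u v => skewInt k u (skewInt k v y)}
      add_mem' := by
        intro x y hx hy
        refine ⟨fun u v huv => ?_, fun u v huv => ?_⟩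
        · simp only [map_add, hx.symm u v huv, hy.symm u v huv]
        · have h1 := hx.twist u v huv
          have h2 := hy.twist u v huv
          simp only [twistedDiff, map_add, smul_add] at h1 h2 ⊢
          rw [add_sub_add_comm, h1, h2, add_sub_add_comm]
      zero_mem' := ⟨fun u v _ => by simp, fun u v _ => by simp [twistedDiff]⟩
      smul_mem' := by
        intro c x hx
        refine ⟨fun u v huv => ?_, fun u v huv => ?_⟩
        · simp only [map_smul, hx.symm u v huv]
        · have h1 := hx.twist u v huv
          simp only [twistedDiff, map_smul] at h1 ⊢
          rw [smul_comm _ c, smul_comm _ c, ← smul_sub, ← smul_sub, h1] }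
  refine h_mul_induction (N := N) ?_ ?_ y
  · have key : ∀ u v : ℤ, skewInt k u (skewInt k v 1) = if u = 0 ∧ v = 0 then 1 else 0 := by
      intro u v
      rw [skewInt_one]
      split_ifs with h1 h2 h2
      · rw [skewInt_one, if_pos h2.1]
      · rw [skewInt_one, if_neg (by tauto)]
      · tauto
      · simp
    refine ⟨fun u v _ => ?_, fun u v huv => ?_⟩
    · simp only [key, and_comm]
    · have : ∀ u v : ℤ, Odd (u + v) → ¬ (u = 0 ∧ v = 0) := by
        rintro _ _ huv ⟨rfl, rfl⟩
        simp at huv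
      simp only [twistedDiff, key]
      rw [if_neg (this _ _ huv), if_neg (this _ _ (by convert huv using 1; ring)),
        if_neg (this _ _ (by convert huv using 1; ring)),
        if_neg (this _ _ (by convert huv using 1; ring))]
      simp
  · intro n y hy
    change OddRel _
    simp only [skewInt_skewInt_h_mul]
    exact OddRel.mul_sum _ fun s => OddRel.convolve hy n s

end QSymFree

/-! ### Straightening words to partitions -/

namespace QSymFree

open Finset

section Straightening

variable {k A : Type*} [CommRing k] [Ring A] [Algebra k A]

/-- The sum of the letters of a list of natural numbers weighted by their positions. -/
def positionWeight : List ℕ → ℕ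
  | [] => 0
  | _ :: l => positionWeight l + l.sum

theorem positionWeight_append (p r : List ℕ) :
    positionWeight (p ++ r) = positionWeight p + positionWeight r + p.length * r.sum := by
  induction p with
  | nil => simp [positionWeight]
  | cons a p ih =>
    simp only [List.cons_append, positionWeight, ih, List.sum_append, List.length_cons]
    ring

theorem exists_ascent : ∀ {l : List ℕ}, ¬ l.Pairwise (· ≥ ·) →
    ∃ p a b s, l = p ++ a :: b :: s ∧ a < b
  | [], h => absurd List.Pairwise.nil h
  | a :: l, h => by
    by_cases hl : l.Pairwise (· ≥ ·)
    · cases l with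
      | nil => simp at h
      | cons b s =>
        rcases lt_or_ge a b with hab | hab
        · exact ⟨[], a, b, s, rfl, hab⟩
        · refine absurd (List.pairwise_cons.2 ⟨fun c hc => ?_, hl⟩) h
          rcases List.mem_cons.1 hc with rfl | hc
          · exact hab
          · exact le_trans ((List.pairwise_cons.1 hl).1 c hc) hab
    · obtain ⟨p, c, d, s, rfl, hcd⟩ := exists_ascent hl
      exact ⟨a :: p, c, d, s, rfl, hcd⟩

theorem prod_mem_span_sorted {H : ℕ → A}
    (hpair : ∀ a b, a < b →
      H a * H b ∈ Submodule.span k {z | ∃ c d, c + d = a + b ∧ d ≤ a ∧ H c * H d = z})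
    (l : List ℕ) : (l.map H).prod ∈ Submodule.span k
      {z | ∃ l' : List ℕ, l'.Pairwise (· ≥ ·) ∧ l'.sum = l.sum ∧ (l'.map H).prod = z} := by
  induction hw : positionWeight l using Nat.strong_induction_on generalizing l with
  | _ w ih =>
    by_cases hl : l.Pairwise (· ≥ ·)
    · exact Submodule.subset_span ⟨l, hl, rfl, rfl⟩
    obtain ⟨p, a, b, s, rfl, hab⟩ := exists_ascent hl
    have key : ∀ z ∈ Submodule.span k {z | ∃ c d, c + d = a + b ∧ d ≤ a ∧ H c * H d = z},
        (p.map H).prod * (z * (s.map H).prod) ∈ Submodule.span k {z | ∃ l' : List ℕ,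
          l'.Pairwise (· ≥ ·) ∧ l'.sum = (p ++ a :: b :: s).sum ∧ (l'.map H).prod = z} := by
      intro z hz
      induction hz using Submodule.span_induction with
      | mem z hz =>
        obtain ⟨c, d, h1, h2, rfl⟩ := hz
        have hsum : (p ++ c :: d :: s).sum = (p ++ a :: b :: s).sum := by
          simp only [List.sum_append, List.sum_cons]
          omega
        -- Only the second letter of the pair matters: the weight changes by `d - b`, which is
        -- negative as `d ≤ a < b`.
        have hlt : positionWeight (p ++ c :: d :: s) < w := by
          have hsum' : (c :: d :: s).sum = (a :: b :: s).sum := by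
            simp only [List.sum_cons]
            omega
          rw [← hw, positionWeight_append, positionWeight_append, hsum']
          simp only [positionWeight, List.sum_cons]
          omega
        have := ih _ hlt (p ++ c :: d :: s) rfl
        rw [hsum] at this
        simpa [mul_assoc] using this
      | zero => simp
      | add x y _ _ hx hy => simpa [add_mul, mul_add] using add_mem hx hy
      | smul r x _ hx => simpa using Submodule.smul_mem _ r hx
    simpa [mul_assoc] using key _ (hpair a b hab)

theorem prod_filter_ne_zero {M : Type*} [Monoid M] {x : ℕ → M} (hx : x 0 = 1) (l : List ℕ) :
    ((l.filter (· ≠ 0)).map x).prod = (l.map x).prod := by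
  induction l with
  | nil => rfl
  | cons a l ih =>
    rcases Nat.eq_zero_or_pos a with rfl | ha
    · simpa [hx] using ih
    · simp [ha.ne'] at ih ⊢
      rw [ih]

theorem exists_partProd_eq {x : ℕ → QSymFree k} (hx : x 0 = 1) {n : ℕ} {l : List ℕ}
    (hl : l.Pairwise (· ≥ ·)) (hn : l.sum = n) :
    ∃ p : n.Partition, partProd x p = (l.map x).prod := by
  refine ⟨Nat.Partition.ofSums n l (by simpa using hn), ?_⟩
  rw [partProd, ← prod_filter_ne_zero hx l]
  congr 2
  have h1 : (l.filter (· ≠ 0)).Pairwise (fun a b => b ≤ a) := hl.filter _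
  refine List.Perm.eq_of_pairwise' (Multiset.pairwise_sort _ _) h1 ?_
  rw [← Multiset.coe_eq_coe, Multiset.sort_eq]
  simp [Nat.Partition.ofSums]

end Straightening

variable {k : Type*} [CommRing k]

theorem skew_one_comm (a b : ℕ) (y : QSymFree k) :
    skew 1 a (skew 1 b y) = skew 1 b (skew 1 a y) := by
  let N : Submodule k (QSymFree k) := ⨅ a, ⨅ b,
    LinearMap.eqLocus (skew (1 : k) a * skew 1 b) (skew 1 b * skew 1 a)
  have hN : ∀ y, y ∈ N ↔ ∀ a b, skew (1 : k) a (skew 1 b y) = skew 1 b (skew 1 a y) := by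
    intro y
    simp [N, Submodule.mem_iInf, LinearMap.mem_eqLocus]
  refine (hN y).1 (h_mul_induction (N := N) ?_ ?_ y) a b
  · rw [hN]
    intro a b
    rw [skew_one, skew_one]
    split_ifs <;> simp [skew_one, *]
  · intro n y hy
    rw [hN] at hy ⊢
    have key : ∀ a b, skew (1 : k) a (skew 1 b (h k n * y)) =
        ∑ x ∈ antidiagonal b, ∑ z ∈ antidiagonal a, if x.1 + z.1 ≤ n then
          h k (n - x.1 - z.1) * skew 1 z.2 (skew 1 x.2 y) else 0 := by
      intro a b
      rw [skew_h_mul, map_sum]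
      refine sum_congr rfl fun x _ => ?_
      split_ifs with hx
      · rw [one_pow, one_smul, skew_h_mul]
        refine sum_congr rfl fun z _ => ?_
        rw [one_pow, one_smul]
        exact if_congr (by omega) rfl rfl
      · rw [map_zero, sum_eq_zero]
        intro z _
        rw [if_neg (by omega)]
    intro a b
    rw [key, key, sum_comm]
    refine sum_congr rfl fun x _ => sum_congr rfl fun z _ => ?_
    rw [hy, Nat.sub_right_comm, add_comm]

theorem adj_one_pair (a b : ℕ) :
    adj (1 : k) (h k a) * adj 1 (h k b) ∈ Submodule.span k {z | ∃ c d, c + d = a + b ∧ d ≤ a ∧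
      adj (1 : k) (h k c) * adj 1 (h k d) = z} := by
  refine Submodule.subset_span ⟨b, a, add_comm _ _, le_rfl, ?_⟩
  rw [adj_h, adj_h, ← MulOpposite.op_mul, ← MulOpposite.op_mul]
  congr 1
  ext1 y
  exact skew_one_comm a b y

/-- Even total degree is plain commutation. In odd total degree the four-term relation lowers the
first letter by one, up to products whose second letter is already small, so induction on the first
letter ends at `h 0 = 1`. -/
theorem adj_neg_one_pair (a b : ℕ) :
    adj (-1 : k) (h k a) * adj (-1) (h k b) ∈ Submodule.span k {z | ∃ c d, c + d = a + b ∧ d ≤ a ∧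
      adj (-1 : k) (h k c) * adj (-1) (h k d) = z} := by
  have hadj : ∀ a b, adj (-1 : k) (h k a) * adj (-1) (h k b) =
      MulOpposite.op (skewInt k b * skewInt k a) := by
    intro a b
    rw [adj_h, adj_h, skewInt_natCast, skewInt_natCast, ← MulOpposite.op_mul]
  induction a generalizing b with
  | zero =>
    refine Submodule.subset_span ⟨b, 0, add_comm _ _, le_rfl, ?_⟩
    simp [h_zero]
  | succ a ih =>
    rcases Nat.even_or_odd (a + 1 + b) with hab | hab
    · refine Submodule.subset_span ⟨b, a + 1, add_comm _ _, le_rfl, ?_⟩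
      rw [hadj, hadj]
      congr 1
      ext1 y
      exact (oddRel_skewInt y).symm (a + 1 : ℕ) b (by exact_mod_cast hab)
    -- The relation `twist` at `(b, a + 1)`, read in the opposite algebra; only the first product on
    -- the right needs the induction hypothesis.
    · have h1 : adj (-1 : k) (h k (a + 1)) * adj (-1) (h k b) =
          (b : ℤ).negOnePow • (adj (-1 : k) (h k a) * adj (-1) (h k (b + 1))) +
          adj (-1 : k) (h k (b + 1)) * adj (-1) (h k a) -
          (a : ℤ).negOnePow • (adj (-1 : k) (h k b) * adj (-1) (h k (a + 1))) := by
        rw [hadj, hadj, hadj, hadj]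
        apply MulOpposite.unop_injective
        ext1 y
        have := (oddRel_skewInt y).twist b (a + 1) (by rw [add_comm]; exact_mod_cast hab)
        simp only [twistedDiff, add_sub_cancel_right] at this
        change skewInt k (b : ℕ) (skewInt k (a + 1 : ℕ) y) =
          (b : ℤ).negOnePow • (skewInt k (b + 1 : ℕ) (skewInt k (a : ℕ) y)) +
          skewInt k (a : ℕ) (skewInt k (b + 1 : ℕ) y) -
          (a : ℤ).negOnePow • (skewInt k (a + 1 : ℕ) (skewInt k (b : ℕ) y))
        push_cast
        rw [add_sub_assoc, ← this, add_sub_cancel]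
      rw [h1, ← neg_one_pow_smul (k := k), ← neg_one_pow_smul (k := k)]
      refine Submodule.sub_mem _ (Submodule.add_mem _ (Submodule.smul_mem _ _ ?_) ?_)
        (Submodule.smul_mem _ _ ?_)
      · refine Submodule.span_mono ?_ (ih (b + 1))
        rintro _ ⟨c, d, h2, h3, rfl⟩
        exact ⟨c, d, by omega, by omega, rfl⟩
      · exact Submodule.subset_span ⟨b + 1, a, by omega, by omega, rfl⟩
      · exact Submodule.subset_span ⟨b, a + 1, by omega, le_rfl, rfl⟩

theorem mem_radical_of_adj_eq_zero {q : k} {x : QSymFree k} (hx : adj q x = 0) : x ∈ radical q := by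
  rw [radical, LinearMap.mem_ker]
  ext1 y
  simp [form_apply, hx]

/-- Straightening takes place in the image of `adj q`. It transfers to the quotient because the
kernel of `adj q` lies in the radical. -/
theorem mkQ_prod_mem_span {q : k}
    (hpair : ∀ a b, adj q (h k a) * adj q (h k b) ∈ Submodule.span k
      {z | ∃ c d, c + d = a + b ∧ d ≤ a ∧ adj q (h k c) * adj q (h k d) = z})
    (l : List ℕ) {n : ℕ} (hn : l.sum = n) : (radical q).mkQ (l.map (h k)).prod ∈
      Submodule.span k (Set.range fun p : n.Partition => (radical q).mkQ (partProd (h k) p)) := by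
  have h1 := prod_mem_span_sorted (fun a b _ => hpair a b) l
  have h2 : Submodule.span k {z | ∃ l' : List ℕ, l'.Pairwise (· ≥ ·) ∧ l'.sum = l.sum ∧
      (l'.map fun a => adj q (h k a)).prod = z} ≤
      (Submodule.span k (Set.range (partProd (h k) (n := n)))).map (adj q).toLinearMap := by
    rw [Submodule.span_le]
    rintro _ ⟨l', hl', hsum, rfl⟩
    obtain ⟨p, hp⟩ := exists_partProd_eq (x := h k) h_zero hl' (hsum.trans hn)
    refine ⟨partProd (h k) p, Submodule.subset_span ⟨p, rfl⟩, ?_⟩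
    rw [hp, AlgHom.toLinearMap_apply, map_list_prod, List.map_map]
    rfl
  obtain ⟨x, hx, hx'⟩ := h2 h1
  have h3 : (radical q).mkQ (l.map (h k)).prod = (radical q).mkQ x := by
    rw [← sub_eq_zero, ← map_sub, ← LinearMap.mem_ker, Submodule.ker_mkQ]
    apply mem_radical_of_adj_eq_zero
    rw [map_sub, ← AlgHom.toLinearMap_apply (adj q) x, hx', map_list_prod, List.map_map]
    exact sub_self _
  rw [h3, Set.range_comp' , ← Submodule.map_span]
  exact Submodule.mem_map_of_mem hx

end QSymFree

/-! ### Elementary functions and their pairing with the `h` words -/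

namespace QSymFree

open Finset

variable {k : Type*} [CommRing k]

/-- The sign `(-1)^n q^{n(n-1)/2}`. -/
def elemSign (q : k) : ℕ → k
  | 0 => 1
  | n + 1 => -q ^ n * elemSign q n

/-- A sequence satisfying the defining relations of the elementary functions for the parameter
`q`. -/
structure IsElementary (q : k) (E : ℕ → QSymFree k) : Prop where
  zero : E 0 = 1
  rel : ∀ n, ∑ i ∈ range (n + 2), elemSign q i • (E i * h k (n + 1 - i)) = 0

theorem isUnit_elemSign {q : k} (hq : IsUnit q) (n : ℕ) : IsUnit (elemSign q n) := by
  induction n with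
  | zero => exact isUnit_one
  | succ n ih => exact ((hq.pow n).neg).mul ih

theorem elemSign_neg_one (n : ℕ) : elemSign (-1 : k) n = (-1) ^ (n * (n + 1) / 2) := by
  induction n with
  | zero => simp [elemSign]
  | succ n ih =>
    have : (n + 1) * (n + 1 + 1) / 2 = n + 1 + n * (n + 1) / 2 := by
      rw [show (n + 1) * (n + 1 + 1) = n * (n + 1) + (n + 1) * 2 by ring,
        Nat.add_mul_div_right _ _ two_pos, add_comm]
    rw [elemSign, ih, this, pow_add, pow_succ, mul_neg_one]

theorem isElementary_e : IsElementary (-1 : k) (e k) where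
  zero := by rw [e]
  rel n := by simpa only [elemSign_neg_one] using e_relation k (n + 1) (by omega)

theorem exists_isElementary {q : k} (hq : IsUnit q) :
    ∃ E : ℕ → QSymFree k, IsElementary q E := by
  let F (n : ℕ) (f : ∀ m < n, QSymFree k) : QSymFree k := if n = 0 then 1 else
    -(Ring.inverse (elemSign q n) •
      ∑ i : Fin n, elemSign q i • (f i i.2 * h k (n - i)))
  let E : ℕ → QSymFree k := WellFounded.fix Nat.lt_wfRel.wf F
  have hE : ∀ n, E n = F n fun m _ => E m := fun n => WellFounded.fix_eq _ _ _
  refine ⟨E, by rw [hE]; simp [F], fun n => ?_⟩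
  rw [sum_range_succ, Nat.sub_self, h_zero, mul_one, hE (n + 1)]
  simp only [F, if_neg (Nat.succ_ne_zero n), smul_neg, smul_smul]
  rw [Ring.mul_inverse_cancel _ (isUnit_elemSign hq _), one_smul, sum_range, add_neg_cancel]

variable {q : k} {E : ℕ → QSymFree k}

theorem IsElementary.rel' (hE : IsElementary q E) (n : ℕ) :
    ∑ i ∈ range (n + 1), elemSign q i • (E i * h k (n + 1 - i)) + elemSign q (n + 1) • E (n + 1) =
      0 := by
  have := hE.rel n
  rwa [sum_range_succ, Nat.sub_self, h_zero, mul_one] at this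

theorem IsElementary.scale (hE : IsElementary q E) (hq : IsUnit q) (c : k) (n : ℕ) :
    scale c (E n) = c ^ n • E n := by
  induction n using Nat.strong_induction_on with
  | _ n ih =>
    cases n with
    | zero => simp [hE.zero]
    | succ n =>
      have h1 := hE.rel' n
      have h2 := congrArg (QSymFree.scale c) h1
      have h3 := congrArg (c ^ (n + 1) • ·) h1
      simp only [smul_add, smul_zero, map_add, map_zero, smul_sum, map_sum, map_smul] at h2 h3
      have h4 : ∀ i ∈ range (n + 1), elemSign q i • QSymFree.scale c (E i * h k (n + 1 - i)) =
          c ^ (n + 1) • elemSign q i • (E i * h k (n + 1 - i)) := by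
        intro i hi
        have hi' : i < n + 1 := by simpa using hi
        rw [map_mul, ih i hi', scale_h, smul_mul_smul_comm, ← pow_add, smul_comm,
          show i + (n + 1 - i) = n + 1 by omega]
      rw [sum_congr rfl h4, ← h3, add_right_inj, smul_comm (c ^ (n + 1))] at h2
      exact (isUnit_elemSign hq _).smul_left_cancel.1 h2

theorem skew_succ_mul {x : QSymFree k} (hx : ∀ i, skew q (i + 2) x = 0) (b : ℕ) (y : QSymFree k) :
    skew q (b + 1) (x * y) = scale (q ^ (b + 1)) x * skew q (b + 1) y +
      scale (q ^ b) (skew q 1 x) * skew q b y := by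
  rw [skew_mul, Nat.sum_antidiagonal_eq_sum_range_succ_mk, sum_range_succ', sum_range_succ',
    sum_eq_zero]
  · simp [skew_zero, add_comm]
  · intro i _
    simp [hx]

/-- Apply `skew q (b + 1)` to the defining relation. The Leibniz rule yields two sums that cancel
after an index shift, because `elemSign` gains the factor `-q ^ i` from `i` to `i + 1`. Only the
last term of the first sum remains, and it vanishes unless `b = 0`. -/
theorem IsElementary.skew_succ (hE : IsElementary q E) (hq : IsUnit q) (n b : ℕ) :
    skew q (b + 1) (E n) = if b = 0 ∧ 0 < n then E (n - 1) else 0 := by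
  induction n using Nat.strong_induction_on generalizing b with
  | _ n ih =>
    cases n with
    | zero => simp [hE.zero, skew_one]
    | succ n =>
      have h1 := congrArg (skew q (b + 1)) (hE.rel' n)
      rw [map_add, map_sum, map_zero, map_smul] at h1
      have h2 : ∀ i ∈ range (n + 1), skew q (b + 1) (elemSign q i • (E i * h k (n + 1 - i))) =
          elemSign q i • q ^ ((b + 1) * i) • (E i * skew q b (h k (n - i))) +
          elemSign q i • if 0 < i then q ^ (b * (i - 1)) •
            (E (i - 1) * skew q b (h k (n + 1 - i))) else 0 := by
        intro i hi
        have hi' : i < n + 1 := by simpa using hi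
        rw [map_smul, skew_succ_mul (fun j => by rw [ih i hi', if_neg (by omega)]),
          hE.scale hq, smul_add, ih i hi']
        congr 2
        · rw [smul_mul_assoc, ← pow_mul, skew_h, skew_h]
          congr 2
          exact if_congr (by omega) (by congr 1; omega) rfl
        · simp only [true_and]
          split_ifs
          · rw [hE.scale hq, ← pow_mul, smul_mul_assoc]
          · simp
      rw [sum_congr rfl h2, sum_add_distrib, sum_range_succ, sum_range_succ' _ n] at h1
      have h3 : ∀ i ∈ range n, (elemSign q (i + 1) • if 0 < i + 1 then q ^ (b * (i + 1 - 1)) •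
            (E (i + 1 - 1) * skew q b (h k (n + 1 - (i + 1)))) else 0) =
          - (elemSign q i • q ^ ((b + 1) * i) • (E i * skew q b (h k (n - i)))) := by
        intro i _
        rw [if_pos i.succ_pos, smul_smul, smul_smul, ← neg_smul, elemSign,
          Nat.add_sub_cancel, Nat.add_sub_add_right]
        congr 1
        ring
      rw [sum_congr rfl h3, sum_neg_distrib] at h1
      simp only [lt_irrefl, if_false, smul_zero, add_zero, Nat.sub_self, h_zero, skew_one] at h1
      have h5 : elemSign q n • q ^ ((b + 1) * n) • (E n * if b = 0 then 1 else 0) +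
          elemSign q (n + 1) • skew q (b + 1) (E (n + 1)) = 0 := by
        refine Eq.trans ?_ h1
        abel
      have h4 : elemSign q (n + 1) • skew q (b + 1) (E (n + 1)) =
          elemSign q (n + 1) • if b = 0 ∧ 0 < n + 1 then E (n + 1 - 1) else 0 := by
        rw [eq_neg_of_add_eq_zero_right h5]
        rcases Nat.eq_zero_or_pos b with rfl | hb
        · simp [elemSign, smul_smul, mul_comm]
        · simp [hb.ne']
      exact (isUnit_elemSign hq _).smul_left_cancel.1 h4

theorem IsElementary.skew_succ_mul (hE : IsElementary q E) (hq : IsUnit q) (n b : ℕ)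
    (y : QSymFree k) : skew q (b + 1) (E (n + 1) * y) =
      q ^ ((b + 1) * (n + 1)) • (E (n + 1) * skew q (b + 1) y) +
        q ^ (b * n) • (E n * skew q b y) := by
  rw [QSymFree.skew_succ_mul (fun i => by rw [hE.skew_succ hq, if_neg (by omega)]), hE.scale hq,
    show (1 : ℕ) = 0 + 1 from rfl, hE.skew_succ hq, if_pos ⟨rfl, n.succ_pos⟩, Nat.add_sub_cancel,
    hE.scale hq, ← pow_mul, ← pow_mul, smul_mul_assoc, smul_mul_assoc, zero_add]

/-- Each factor of positive index absorbs at most one unit of `b`, and `E 0 = 1` absorbs none. -/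
theorem IsElementary.skew_prod_eq_zero (hE : IsElementary q E) (hq : IsUnit q) (w : List ℕ)
    {b : ℕ} (hb : w.countP (0 < ·) < b) : skew q b (w.map E).prod = 0 := by
  induction w generalizing b with
  | nil =>
    have : b ≠ 0 := by rintro rfl; simp at hb
    simp [skew_one, this]
  | cons n w ih =>
    cases n with
    | zero => simpa [hE.zero] using ih (by simpa using hb)
    | succ n =>
      rw [List.countP_cons_of_pos (by simp)] at hb
      obtain ⟨b, rfl⟩ : ∃ c, b = c + 1 := ⟨b - 1, by omega⟩
      rw [List.map_cons, List.prod_cons, hE.skew_succ_mul hq, ih (by omega), ih (by omega)]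
      simp

/-- In the extreme case every factor of positive index must absorb exactly one unit, so the first
column of the diagram with rows `w` is removed. -/
theorem IsElementary.skew_prod (hE : IsElementary q E) (hq : IsUnit q) (w : List ℕ) :
    ∃ t : ℕ, skew q (w.countP (0 < ·)) (w.map E).prod = q ^ t • ((w.map Nat.pred).map E).prod := by
  induction w with
  | nil => exact ⟨0, by simp [skew_zero]⟩
  | cons n w ih =>
    obtain ⟨t, ht⟩ := ih
    cases n with
    | zero => exact ⟨t, by simpa [hE.zero] using ht⟩
    | succ n =>
      refine ⟨w.countP (0 < ·) * n + t, ?_⟩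
      rw [List.countP_cons_of_pos (by simp), List.map_cons, List.prod_cons, hE.skew_succ_mul hq,
        hE.skew_prod_eq_zero hq w (Nat.lt_succ_self _), ht, mul_zero, smul_zero, zero_add,
        mul_smul_comm, smul_smul, ← pow_add]
      simp

theorem form_h_mul (b : ℕ) (x y : QSymFree k) : form q (h k b * x) y = form q x (skew q b y) := by
  rw [form_apply, form_apply, map_mul, adj_h, MulOpposite.unop_mul, MulOpposite.unop_op,
    Module.End.mul_apply]

theorem countP_map_pred (w : List ℕ) (i : ℕ) :
    (w.map Nat.pred).countP (i < ·) = w.countP (i + 1 < ·) := by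
  rw [List.countP_map]
  refine List.countP_congr fun a _ => ?_
  simp only [Function.comp, decide_eq_true_eq, Nat.pred_eq_sub_one]
  omega

/-- The counts `w.countP (j < ·)` are the column lengths of `w`. Letters of `l` equal to them strip
columns one at a time; the first letter exceeding its column kills the product. -/
theorem IsElementary.form_eq_zero (hE : IsElementary q E) (hq : IsUnit q) {l w : List ℕ} {i : ℕ}
    (hi : w.countP (i < ·) < l.getD i 0) (hj : ∀ j < i, l.getD j 0 = w.countP (j < ·)) :
    form q (l.map (h k)).prod (w.map E).prod = 0 := by
  induction l generalizing w i with
  | nil => simp at hi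
  | cons b l ih =>
    rw [List.map_cons, List.prod_cons, form_h_mul]
    cases i with
    | zero =>
      rw [hE.skew_prod_eq_zero hq w (by simpa using hi), map_zero]
    | succ i =>
      obtain ⟨t, ht⟩ := hE.skew_prod hq w
      have hb : b = w.countP (0 < ·) := by simpa using hj 0 i.succ_pos
      rw [hb, ht, map_smul, ih (i := i), smul_zero]
      · rw [countP_map_pred]
        simpa using hi
      · intro j hji
        rw [countP_map_pred]
        simpa using hj (j + 1) (Nat.succ_lt_succ hji)

theorem IsElementary.form_eq_pow (hE : IsElementary q E) (hq : IsUnit q) {l w : List ℕ}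
    (hl : ∀ i, l.getD i 0 = w.countP (i < ·)) :
    ∃ t : ℕ, form q (l.map (h k)).prod (w.map E).prod = q ^ t := by
  induction l generalizing w with
  | nil =>
    have hw : w.map E = w.map fun _ => 1 := by
      refine List.map_congr_left fun a ha => ?_
      have h0 : w.countP (0 < ·) = 0 := by simpa using (hl 0).symm
      have := (List.countP_eq_zero.1 h0) a ha
      simp only [decide_eq_true_eq, not_lt, nonpos_iff_eq_zero] at this
      rw [this, hE.zero]
    refine ⟨0, ?_⟩
    rw [hw, form_apply]
    simp
  | cons b l ih =>
    obtain ⟨t, ht⟩ := hE.skew_prod hq w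
    have hb : b = w.countP (0 < ·) := by simpa using hl 0
    obtain ⟨t', ht'⟩ := ih (w := w.map Nat.pred) fun i => by
      rw [countP_map_pred]
      simpa using hl (i + 1)
    refine ⟨t + t', ?_⟩
    rw [List.map_cons, List.prod_cons, form_h_mul, hb, ht, map_smul, ht', smul_eq_mul, pow_add]

end QSymFree

/-! ### Conjugate partitions and the triangular pairing -/

namespace QSymFree

open Finset

/-- Both sides say that the cell in row `i` and column `j` lies in the Young diagram of `l`. -/
theorem lt_countP_iff {l : List ℕ} (hl : l.Pairwise (fun a b => b ≤ a)) (i j : ℕ) :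
    i < l.countP (j < ·) ↔ j < l.getD i 0 := by
  induction l generalizing i with
  | nil => simp
  | cons a l ih =>
    obtain ⟨ha, hl⟩ := List.pairwise_cons.1 hl
    by_cases hj : j < a
    · rw [List.countP_cons_of_pos (by simpa using hj)]
      cases i with
      | zero => simpa using hj
      | succ i => simpa using ih hl i
    · have h0 : l.countP (j < ·) = 0 := by
        rw [List.countP_eq_zero]
        intro b hb
        have := ha b hb
        simp only [decide_eq_true_eq]
        omega
      rw [List.countP_cons_of_neg (by simpa using hj)]
      cases i with
      | zero => simpa [h0] using hj
      | succ i =>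
        have := ih hl i
        rw [h0] at this ⊢
        simpa using this

theorem eq_of_getD_eq {l l' : List ℕ} (hl : 0 ∉ l) (hl' : 0 ∉ l')
    (h : ∀ i, l.getD i 0 = l'.getD i 0) : l = l' := by
  induction l generalizing l' with
  | nil =>
    cases l' with
    | nil => rfl
    | cons a l' =>
      have : 0 = a := by simpa using h 0
      simp [← this] at hl'
  | cons b l ih =>
    cases l' with
    | nil =>
      have : b = 0 := by simpa using h 0
      simp [this] at hl
    | cons a l' =>
      have h1 : b = a := by simpa using h 0
      rw [h1, ih (fun h => hl (List.mem_cons_of_mem _ h)) (fun h => hl' (List.mem_cons_of_mem _ h))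
        fun i => by simpa using h (i + 1)]

theorem sum_countP (s : Multiset ℕ) (n : ℕ) (hs : ∀ a ∈ s, a ≤ n) :
    ∑ j ∈ range n, s.countP (j < ·) = s.sum := by
  induction s using Multiset.induction_on with
  | empty => simp
  | cons a s ih =>
    have ha : {j ∈ range n | j < a} = range a := by
      ext j
      have := hs a (Multiset.mem_cons_self a s)
      simp only [mem_filter, mem_range]
      omega
    simp only [Multiset.countP_cons, sum_add_distrib, sum_boole, Multiset.sum_cons, ha, card_range,
      ih fun b hb => hs b (Multiset.mem_cons_of_mem hb), Nat.cast_id, add_comm]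

/-- The row lengths of a partition, in decreasing order and extended by zero. -/
def rowLength {n : ℕ} (p : n.Partition) (i : ℕ) : ℕ :=
  (p.parts.sort (fun a b => b ≤ a)).getD i 0

theorem rowLength_injective (n : ℕ) : Function.Injective (rowLength (n := n)) := by
  intro p p' h
  have h0 : ∀ p : n.Partition, 0 ∉ p.parts.sort (fun a b => b ≤ a) := by
    intro p hp
    exact (p.parts_pos (by simpa using hp)).ne rfl
  have := eq_of_getD_eq (h0 p) (h0 p') (congrFun h)
  ext1
  rw [← Multiset.sort_eq p.parts (fun a b => b ≤ a), this, Multiset.sort_eq]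

theorem le_of_mem_parts {n : ℕ} (p : n.Partition) {a : ℕ} (ha : a ∈ p.parts) : a ≤ n := by
  rw [← p.parts_sum]
  exact Multiset.le_sum_of_mem ha

/-- The conjugate partition. -/
def conjugate {n : ℕ} (p : n.Partition) : n.Partition :=
  Nat.Partition.ofSums n ((Multiset.range n).map fun j => p.parts.countP (j < ·)) <| by
    exact (sum_countP p.parts n fun a ha => le_of_mem_parts p ha).trans p.parts_sum

theorem countP_sort {n : ℕ} (p : n.Partition) (i : ℕ) :
    (p.parts.sort (fun a b => b ≤ a)).countP (i < ·) = p.parts.countP (i < ·) := by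
  conv_rhs => rw [← Multiset.sort_eq p.parts (fun a b => b ≤ a), Multiset.coe_countP]

theorem rowLength_le {n : ℕ} (p : n.Partition) (i : ℕ) : rowLength p i ≤ n := by
  by_contra! h
  rw [rowLength, ← lt_countP_iff (Multiset.pairwise_sort _ _), countP_sort,
    Multiset.countP_eq_zero.2] at h
  · simp at h
  · intro a ha
    exact not_lt.2 (le_of_mem_parts p ha)

theorem countP_conjugate {n : ℕ} (p : n.Partition) (i : ℕ) :
    (conjugate p).parts.countP (i < ·) = rowLength p i := by
  have h1 : (conjugate p).parts =
    ((Multiset.range n).map fun j => p.parts.countP (j < ·)).filter (· ≠ 0) := rfl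
  have h2 : {j ∈ range n | i < p.parts.countP (j < ·)} = range (rowLength p i) := by
    ext j
    have := rowLength_le p i
    rw [mem_filter, mem_range, mem_range, ← countP_sort, lt_countP_iff (Multiset.pairwise_sort _ _)]
    change _ ∧ j < rowLength p i ↔ _
    omega
  rw [h1, Multiset.countP_filter]
  have h3 : ∀ a, (i < a ∧ a ≠ 0) ↔ i < a := fun a => by omega
  simp only [h3]
  rw [Multiset.countP_map, ← card_range (rowLength p i), ← h2]
  rfl

theorem conjugate_bijective (n : ℕ) : Function.Bijective (conjugate (n := n)) := by
  refine Finite.injective_iff_bijective.1 fun p p' h => rowLength_injective n ?_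
  ext i
  rw [← countP_conjugate, h, countP_conjugate]

variable {k : Type*} [CommRing k]

theorem IsElementary.isUnit_det {q : k} {E : ℕ → QSymFree k} (hE : IsElementary q E)
    (hq : IsUnit q) (n : ℕ) :
    IsUnit (Matrix.of fun p p' : n.Partition =>
      form q (partProd (h k) p) (partProd E (conjugate p'))).det := by
  -- Lexicographic order on row lengths: the first row where `p` exceeds `p'` is exactly where
  -- `form_eq_zero` applies.
  let key : n.Partition → Lex (ℕ → ℕ) := fun p => toLex (rowLength p)
  have hkey : Function.Injective key := fun p p' h => rowLength_injective n (toLex.injective h)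
  let _ : LinearOrder n.Partition := LinearOrder.lift' key hkey
  have hcount : ∀ (p : n.Partition) i,
      ((conjugate p).parts.sort (fun a b => b ≤ a)).countP (i < ·) = rowLength p i := by
    intro p i
    rw [countP_sort, countP_conjugate]
  have htri : (Matrix.of fun p p' : n.Partition =>
      form q (partProd (h k) p) (partProd E (conjugate p'))).BlockTriangular id := by
    intro p p' hlt
    obtain ⟨i, hj, hi⟩ : key p' < key p := hlt
    refine hE.form_eq_zero hq (i := i) ?_ fun j hji => ?_
    · rw [hcount]
      exact hi
    · rw [hcount]
      exact (hj j hji).symm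
  have hdet := Matrix.det_of_isUpperTriangular htri
  have : IsUnit (∏ p : n.Partition, form q (partProd (h k) p) (partProd E (conjugate p))) := by
    rw [IsUnit.prod_univ_iff]
    intro p
    obtain ⟨t, ht⟩ := hE.form_eq_pow hq (l := p.parts.sort (fun a b => b ≤ a))
      (w := (conjugate p).parts.sort (fun a b => b ≤ a)) fun i => (hcount p i).symm
    rw [partProd, partProd, ht]
    exact hq.pow t
  convert this
  convert hdet using 1
  exact prod_congr rfl fun _ _ => rfl

/-! ### Homogeneity of the `h` and `E` products -/

theorem one_mem_degreePart : (1 : QSymFree k) ∈ degreePart k 0 :=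
  Submodule.subset_span ⟨1, rfl, by rw [basis_eq_prod]; rfl⟩

theorem mul_mem_degreePart {m n : ℕ} {x y : QSymFree k} (hx : x ∈ degreePart k m)
    (hy : y ∈ degreePart k n) : x * y ∈ degreePart k (m + n) := by
  have : x * y ∈ degreePart k m * degreePart k n := Submodule.mul_mem_mul hx hy
  rw [degreePart, degreePart, Submodule.span_mul_span] at this
  refine Submodule.span_mono ?_ this
  rintro _ ⟨_, ⟨w, hw, rfl⟩, _, ⟨w', hw', rfl⟩, rfl⟩
  refine ⟨w * w', ?_, ?_⟩
  · simp only [Set.mem_ofPred_eq, wordDegree, FreeMonoid.toList_mul, List.map_append,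
      List.sum_append] at *
    rw [hw, hw']
  · simp [basis_eq_prod]

theorem h_mem_degreePart (n : ℕ) : h k n ∈ degreePart k n := by
  rcases Nat.eq_zero_or_pos n with rfl | hn
  · rw [h_zero]
    exact one_mem_degreePart
  · lift n to ℕ+ using hn
    refine Submodule.subset_span ⟨FreeMonoid.of n, ?_, ?_⟩
    · simp [wordDegree]
    · simp [basis_eq_prod]

theorem IsElementary.mem_degreePart {q : k} {E : ℕ → QSymFree k} (hE : IsElementary q E)
    (hq : IsUnit q) (n : ℕ) : E n ∈ degreePart k n := by
  induction n using Nat.strong_induction_on with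
  | _ n ih =>
    cases n with
    | zero =>
      rw [hE.zero]
      exact one_mem_degreePart
    | succ n =>
      obtain ⟨u, hu⟩ := isUnit_elemSign hq (n + 1)
      have h1 := eq_neg_of_add_eq_zero_right (hE.rel' n)
      rw [← hu] at h1
      have h2 : E (n + 1) = (↑u⁻¹ : k) • -∑ i ∈ range (n + 1),
          elemSign q i • (E i * h k (n + 1 - i)) := by
        rw [← h1, smul_smul, Units.inv_mul, one_smul]
      rw [h2]
      refine Submodule.smul_mem _ _ (Submodule.neg_mem _ (Submodule.sum_mem _ fun i hi => ?_))
      have hi' : i < n + 1 := by simpa using hi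
      have := mul_mem_degreePart (ih i hi') (h_mem_degreePart (k := k) (n + 1 - i))
      rw [show i + (n + 1 - i) = n + 1 by omega] at this
      exact Submodule.smul_mem _ _ this

theorem partProd_mem_degreePart {x : ℕ → QSymFree k} (hx : ∀ n, x n ∈ degreePart k n) {n : ℕ}
    (p : n.Partition) : partProd x p ∈ degreePart k n := by
  have key : ∀ l : List ℕ, (l.map x).prod ∈ degreePart k l.sum := by
    intro l
    induction l with
    | nil => exact one_mem_degreePart
    | cons a l ih => exact mul_mem_degreePart (hx a) ih
  have := key (p.parts.sort (fun a b => b ≤ a))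
  rwa [← Multiset.sum_coe, Multiset.sort_eq, p.parts_sum] at this

end QSymFree

/-! ### Passage to the quotient and the two bases -/

namespace QSym

open QSymFree

variable {k : Type*} [CommRing k]

/-- The form on `Λ'` descends to `Λ^q`. -/
theorem exists_form (q : k) : ∃ B : LinearMap.BilinForm k (QSym q), ∀ x y,
    B ((radical q).mkQ x) ((radical q).mkQ y) = form q x y := by
  let φ : QSym q →ₗ[k] QSymFree k →ₗ[k] k := (radical q).liftQ (form q) le_rfl
  have hφ : radical q ≤ LinearMap.ker φ.flip := by
    intro y hy
    rw [LinearMap.mem_ker]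
    ext x
    change form q x y = 0
    rw [form_comm, LinearMap.mem_ker.1 hy, LinearMap.zero_apply]
  refine ⟨(radical q).liftQ φ.flip hφ, fun x y => ?_⟩
  change form q y x = _
  exact form_comm q y x

/-- A relation among the `v i` is annihilated by the invertible pairing matrix, so `v` is a basis.
The pairing matrix then factors through the coordinate matrix of `w` in `v`, whose determinant is
therefore a unit. -/
theorem exists_basis_of_isUnit_det {ι M : Type*} [Fintype ι] [DecidableEq ι] [AddCommGroup M]
    [Module k M] (B : LinearMap.BilinForm k M) (v w : ι → M)
    (hv : ⊤ ≤ Submodule.span k (Set.range v))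
    (hdet : IsUnit (Matrix.of fun i j => B (v i) (w j)).det) :
    (∃ b : Module.Basis ι k M, ⇑b = v) ∧ ∃ b : Module.Basis ι k M, ⇑b = w := by
  have hli : LinearIndependent k v := by
    rw [Fintype.linearIndependent_iff]
    intro c hc
    have h1 : Matrix.vecMul c (Matrix.of fun i j => B (v i) (w j)) = 0 := by
      ext j
      have := congrArg (fun x => B x (w j)) hc
      simpa [Matrix.vecMul, dotProduct, LinearMap.sum_apply] using this
    have h2 := congrArg (fun x => Matrix.vecMul x (Matrix.of fun i j => B (v i) (w j))⁻¹) h1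
    rw [Matrix.vecMul_vecMul, Matrix.mul_nonsing_inv _ hdet, Matrix.vecMul_one,
      Matrix.zero_vecMul] at h2
    exact congrFun h2
  let b := Module.Basis.mk hli hv
  have hb : ⇑b = v := Module.Basis.coe_mk hli hv
  refine ⟨⟨b, hb⟩, ?_⟩
  have hw : IsUnit (b.det w) := by
    have : (Matrix.of fun i j => B (v i) (w j)) =
        (Matrix.of fun i j => B (v i) (v j)) * b.toMatrix w := by
      ext i j
      rw [Matrix.mul_apply, Matrix.of_apply]
      conv_lhs => rw [← b.sum_repr (w j), map_sum]
      refine Finset.sum_congr rfl fun l _ => ?_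
      rw [map_smul, smul_eq_mul, mul_comm, hb]
      rfl
    rw [this, Matrix.det_mul] at hdet
    exact isUnit_of_mul_isUnit_right hdet
  obtain ⟨h1, h2⟩ := (Module.Basis.is_basis_iff_det b).2 hw
  exact ⟨Module.Basis.mk h1 h2.ge, Module.Basis.coe_mk h1 h2.ge⟩

theorem exists_bases {q : k} (hq : IsUnit q) {E : ℕ → QSymFree k} (hE : IsElementary q E)
    (hpair : ∀ a b, adj q (h k a) * adj q (h k b) ∈ Submodule.span k
      {z | ∃ c d, c + d = a + b ∧ d ≤ a ∧ adj q (h k c) * adj q (h k d) = z}) (n : ℕ) :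
    (∃ b : Module.Basis n.Partition k (degreePart q n),
      ∀ l, (b l : QSym q) = (radical q).mkQ (partProd (h k) l)) ∧
    ∃ b : Module.Basis n.Partition k (degreePart q n),
      ∀ l, (b l : QSym q) = (radical q).mkQ (partProd E l) := by
  obtain ⟨B, hB⟩ := exists_form q
  let σ := Equiv.ofBijective _ (conjugate_bijective n)
  let v : n.Partition → degreePart q n := fun p => ⟨(radical q).mkQ (partProd (h k) p),
    Submodule.mem_map_of_mem (partProd_mem_degreePart h_mem_degreePart p)⟩
  let w : n.Partition → degreePart q n := fun p => ⟨(radical q).mkQ (partProd E p),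
    Submodule.mem_map_of_mem (partProd_mem_degreePart (hE.mem_degreePart hq) p)⟩
  have hv : ⊤ ≤ Submodule.span k (Set.range v) := by
    rw [← Submodule.map_le_map_iff_of_injective (degreePart q n).injective_subtype,
      Submodule.map_span, Submodule.map_top, Submodule.range_subtype, ← Set.range_comp]
    change (QSymFree.degreePart k n).map _ ≤ _
    rw [QSymFree.degreePart, Submodule.map_span, Submodule.span_le]
    rintro _ ⟨_, ⟨u, hu, rfl⟩, rfl⟩
    have := mkQ_prod_mem_span hpair ((FreeMonoid.toList u).map fun a : ℕ+ => (a : ℕ)) hu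
    rw [basis_eq_prod]
    rwa [List.map_map] at this
  have hdet : IsUnit (Matrix.of fun p p' =>
      B.restrict (degreePart q n) (v p) ((w ∘ σ) p')).det := by
    convert hE.isUnit_det hq n using 5 with p p'
    exact hB _ _
  obtain ⟨⟨b, hb⟩, b', hb'⟩ := exists_basis_of_isUnit_det _ v (w ∘ σ) hv hdet
  refine ⟨⟨b, fun l => by rw [hb]⟩, b'.reindex σ, fun l => ?_⟩
  rw [Module.Basis.reindex_apply, hb', Function.comp, Equiv.apply_symm_apply]

end QSym

theorem mainTheorem3 (k : Type*) [CommRing k] (n : ℕ) :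
    Module.Free k (QSym.degreePart (-1 : k) n) ∧
    (∃ b : Module.Basis n.Partition k (QSym.degreePart (-1 : k) n),
      ∀ l : n.Partition, (b l : QSym (-1 : k)) = QSym.hPart k l) ∧
    (∃ b : Module.Basis n.Partition k (QSym.degreePart (-1 : k) n),
      ∀ l : n.Partition, (b l : QSym (-1 : k)) = QSym.ePart k l) ∧
    (Nontrivial k →
      Module.finrank k (QSym.degreePart (-1 : k) n) =
        Module.finrank k (QSym.degreePart (1 : k) n) ∧
      Module.finrank k (QSym.degreePart (-1 : k) n) = Fintype.card n.Partition) := by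
  obtain ⟨⟨b, hb⟩, b', hb'⟩ := QSym.exists_bases (k := k) isUnit_one.neg
    QSymFree.isElementary_e QSymFree.adj_neg_one_pair n
  refine ⟨Module.Free.of_basis b, ⟨b, hb⟩, ⟨b', hb'⟩, fun _ => ?_⟩
  -- At `q = 1` the sequence `E` serves only as the dual family that proves the `h_λ` independent.
  obtain ⟨E, hE⟩ := QSymFree.exists_isElementary (k := k) isUnit_one
  obtain ⟨⟨b₁, -⟩, -⟩ := QSym.exists_bases isUnit_one hE QSymFree.adj_one_pair n
  rw [Module.finrank_eq_card_basis b, Module.finrank_eq_card_basis b₁]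
  exact ⟨rfl, rfl⟩
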